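/- Let $D,c_1,c_2,r>0$, $c=(c_1^{-1}+c_2^{-1})^{-1}$, and let $y\in\mathbb{R}$ satisfy $-y\ge r/(4c)$. Let $h:[0,D]\to[0,\infty)$ be strictly increasing and Lipschitz continuous with $h(0)=0$. Let $\beta_0\in[0,D]$ be the solution of $\frac{r^2}{4c}+ry+h(\beta_0)=0$ if $\frac{r^2}{4c}+ry\ge -h(D)$, and $\beta_0=D$ otherwise. Let $\mathcal P$ be the set of continuous functions $[0,\infty)\to\mathbb{R}$ that vanish at $0$, and $\mathcal E$ the set of nonnegative, nondecreasing, right-continuous functions on $[0,\infty)$ (a positive value at $0$ counts as a jump at time $0$). For $x\in[0,D]$, $\psi=(\psi^1,\psi^2)\in\mathcal P^2$ and $\varrho\in\mathcal E$ let $$\varphi(t)=x+yt+\psi^1(t)-\psi^2(t)-\varrho(t),\qquad \tau=\inf\{t\ge0:\varphi(t)=0\}\in[0,\infty],$$ and, when $\tau<\infty$, let the cost be $$\bar c(x,\psi,\varrho)=\int_0^\tau h(\varphi(t))\,dt+r\varrho(\tau)-c_1\int_0^\tau(\dot\psi^1)^2dt-c_2\int_0^\tau(\dot\psi^2)^2dt,$$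 where $\int_0^\tau(\dot\psi^i)^2dt=\infty$ if $\psi^i$ is not absolutely continuous on $[0,\tau]$. A strategy is a map $\alpha:\mathcal P^2\to\mathcal E$ that is causal: if $\psi=\tilde\psi$ on $[0,t]$ then $\alpha[\psi]=\alpha[\tilde\psi]$ on $[0,t]$. It is admissible for $x$ if for every $\psi\in\mathcal P^2$ the dynamics $\varphi$ with $\varrho=\alpha[\psi]$ satisfy $\varphi(t)\in[0,D]$ for all finite $t\in[0,\tau]$. Let $\mathcal Q[x,\alpha]$ be the set of $\psi\in\mathcal P^2$ with $\tau<\infty$ for $\varrho=\alpha[\psi]$, and let $$U(x)=\inf_{\alpha}\ \sup_{\psi\in\mathcal Q[x,\alpha]}\bar c(x,\psi,\alpha[\psi]),$$ the infimum being over the admissible strategies. A $\beta_0$-barrier strategy for $x$ is an admissible strategy $\alpha$ such that for every $\psi\in\mathcal Q[x,\alpha]$, on the time interval $[0,\tau]$ the triple $(\varphi,0,\alpha[\psi])$ solves the Skorohod problem on $[0,\beta_0]$ for the input $x+yt+\psi^1(t)-\psi^2(t)$; that is, $\varphi\in[0,\beta_0]$ on $[0,\tau]$, and on $[0,\tau]$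 the measure $d\alpha[\psi]$ (including an atom of mass $\alpha[\psi](0)$ at $0$) does not charge $\{t:\varphi(t)<\beta_0\}$. Let $x\in[0,\beta_0]$. We say that we are in the non-degenerate case if $y^2-h(\beta_0)/c>0$ or $x<\beta_0$, and in the degenerate case if $y^2-h(\beta_0)/c=0$ and $x=\beta_0$. Let $\delta=0$ in the non-degenerate case, and let $\delta>0$ with $x+y\delta\ge0$ in the degenerate case. Put $$\tilde\tau=\delta+\int_0^{x+y\delta}\frac{d\xi}{\sqrt{y^2-h(\xi)/c}},$$ and let $\omega$ be continuous on $[0,\tilde\tau]$, $\omega=0$ on $[0,\delta]$, with $$\dot\omega(t)=-y-\sqrt{y^2-h\big((x+yt+\omega(t))\wedge(x+y\delta)\big)/c},\qquad t\in[\delta,\tilde\tau].$$ Let $\psi\in\mathcal P^2$ satisfy $\psi(t)=\big(\frac{c}{c_1}\omega(t),-\frac{c}{c_2}\omega(t)\big)$ for $t\in[0,\tilde\tau]$ (with any continuation after $\tilde\tau$). Then a $\beta_0$-barrier strategy for $x$ exists, $\omega$ exists and is unique on $[0,\tilde\tau]$, such a $\psi$ exists, $U(x)$ is finite, and for every $\beta_0$-barrier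 strategy $\bar\alpha_{\beta_0}$ for $x$ the following hold. 1. $U(x)=\sup_{\tilde\psi\in\mathcal Q[x,\bar\alpha_{\beta_0}]}\bar c(x,\tilde\psi,\bar\alpha_{\beta_0}[\tilde\psi])$. 2. In the non-degenerate case, $\bar c(x,\psi,\bar\alpha_{\beta_0}[\psi])=U(x)$; so $\psi$ is an optimal response to $\bar\alpha_{\beta_0}$. 3. In the degenerate case there is a constant $C>0$, not depending on $\delta$, such that $|\bar c(x,\psi,\bar\alpha_{\beta_0}[\psi])-U(x)|\le C\delta$ for every $\delta>0$ with $x+y\delta\ge0$. 4. In both cases, for every such $\delta$, the termination time $\tau$ of the dynamics under $\psi$ and $\bar\alpha_{\beta_0}[\psi]$ equals $\tilde\tau$. -/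

import Mathlib

open Set MeasureTheory
open scoped ENNReal

noncomputable section

namespace HittingGame

/-- The space of continuous paths on `[0,∞)` starting at zero (the values of the function at
negative times play no role). -/
structure Path where
  toFun : ℝ → ℝ
  continuousOn' : ContinuousOn toFun (Ici 0)
  map_zero' : toFun 0 = 0

instance : CoeFun Path (fun _ => ℝ → ℝ) := ⟨Path.toFun⟩

/-- The space of nonnegative, nondecreasing, right-continuous functions on `[0,∞)`. Left limits
exist automatically by monotonicity; a positive value at zero is a jump at time zero. -/
structure Control where
  toFun : ℝ → ℝ
  nonneg' : ∀ t, 0 ≤ t → 0 ≤ toFun t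
  monotoneOn' : MonotoneOn toFun (Ici 0)
  right_continuous' : ∀ t, 0 ≤ t → ContinuousWithinAt toFun (Ici t) t

instance : CoeFun Control (fun _ => ℝ → ℝ) := ⟨Control.toFun⟩

instance : Zero Control :=
  ⟨⟨fun _ => 0, fun _ _ => le_rfl, fun _ _ _ _ _ => le_rfl,
    fun _ _ => continuousWithinAt_const⟩⟩

/-- The extension of a control by `0` to negative times, as a Stieltjes function; its measure has
an atom of mass `η 0` at time `0`, according to the convention `η(0-) = 0`. -/
def Control.stieltjes (η : Control) : StieltjesFunction ℝ where
  toFun t := if t < 0 then 0 else η t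
  mono' := by
    intro s t hst
    by_cases hs : s < 0
    · by_cases ht : t < 0
      · simp [hs, ht]
      · simpa [hs, ht] using η.nonneg' t (not_lt.mp ht)
    · have ht : ¬ t < 0 := fun ht => hs (lt_of_le_of_lt hst ht)
      simpa [hs, ht] using η.monotoneOn' (not_lt.mp hs) (not_lt.mp ht) hst
  right_continuous' := by
    intro t
    by_cases ht : t < 0
    · apply ContinuousAt.continuousWithinAt
      have h0 : (fun s : ℝ => if s < 0 then (0 : ℝ) else η s) =ᶠ[nhds t] fun _ => 0 := by
        filter_upwards [Iio_mem_nhds ht] with s hs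
        simp only [mem_Iio] at hs
        simp [hs]
      exact continuousAt_const.congr h0.symm
    · have ht0 : 0 ≤ t := not_lt.mp ht
      refine (η.right_continuous' t ht0).congr (fun s hs => ?_) (by simp [ht])
      have hs0 : ¬ s < 0 := not_lt.mpr (ht0.trans hs)
      simp [hs0]

/-- `(φ, η₁, η₂)` solves the Skorohod problem on the interval `[a,b]` for the input `w`, on the
time interval `[0,T]`. -/
structure IsSkorohodSolution (a b T : ℝ) (w φ : ℝ → ℝ) (η₁ η₂ : Control) : Prop where
  eq : ∀ t ∈ Icc 0 T, φ t = w t + η₁ t - η₂ t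
  mem : ∀ t ∈ Icc 0 T, φ t ∈ Icc a b
  lower : η₁.stieltjes.measure {t | t ∈ Icc 0 T ∧ φ t ∈ Ioc a b} = 0
  upper : η₂.stieltjes.measure {t | t ∈ Icc 0 T ∧ φ t ∈ Ico a b} = 0

/-- A strategy of the minimizer: a causal map from pairs of paths to controls. -/
structure Strategy where
  toFun : Path × Path → Control
  causal' : ∀ (ψ χ : Path × Path) (t : ℝ), 0 ≤ t →
    (∀ s ∈ Icc 0 t, ψ.1 s = χ.1 s ∧ ψ.2 s = χ.2 s) →
    ∀ s ∈ Icc 0 t, toFun ψ s = toFun χ s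

instance : CoeFun Strategy (fun _ => Path × Path → Control) := ⟨Strategy.toFun⟩

/-- The rate function `I(T,ψ) = k ∫₀ᵀ ψ̇(s)² ds` for absolutely continuous `ψ` on `[0,T]`, and
`∞` otherwise. -/
def pathRate (k T : ℝ) (ψ : Path) : ℝ≥0∞ :=
  open Classical in
  if AbsolutelyContinuousOnInterval ψ 0 T then
    ∫⁻ s in Ioc 0 T, ENNReal.ofReal (k * (deriv ψ s) ^ 2)
  else ⊤

end HittingGame

open HittingGame in
/-- The data of the game: the buffer size `D`, the constants `c₁, c₂` of the rate function, the
rejection penalty `r`, the drift `y`, and the holding cost `h` on `[0,D]` (the values of `h`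
outside `[0,D]` play no role). -/
structure HittingGame where
  D : ℝ
  c₁ : ℝ
  c₂ : ℝ
  r : ℝ
  y : ℝ
  h : ℝ → ℝ
  D_pos : 0 < D
  c₁_pos : 0 < c₁
  c₂_pos : 0 < c₂
  r_pos : 0 < r
  h_continuousOn : ContinuousOn h (Icc 0 D)
  h_strictMonoOn : StrictMonoOn h (Icc 0 D)
  h_zero : h 0 = 0

namespace HittingGame

variable (G : HittingGame)

def c : ℝ := (G.c₁⁻¹ + G.c₂⁻¹)⁻¹

/-- The free boundary point: the solution in `[0,D]` of `r²/(4c) + r y + h(β) = 0`, or `D` if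
`r²/(4c) + r y < -h(D)`. -/
def β₀ : ℝ :=
  open Classical in
  if G.r ^ 2 / (4 * G.c) + G.r * G.y < -G.h G.D then G.D
  else Function.invFunOn G.h (Icc 0 G.D) (-G.r ^ 2 / (4 * G.c) - G.r * G.y)

/-- The uncontrolled dynamics `x + y t + ψ¹(t) - ψ²(t)`. -/
def free (x : ℝ) (ψ : Path × Path) (t : ℝ) : ℝ := x + G.y * t + ψ.1 t - ψ.2 t

/-- The dynamics `φ(t) = x + y t + ψ¹(t) - ψ²(t) - ϱ(t)`. -/
def dyn (x : ℝ) (ψ : Path × Path) (ϱ : Control) (t : ℝ) : ℝ := G.free x ψ t - ϱ t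

/-- The termination time `τ = inf {t ≥ 0 : φ(t) = 0}`, with `inf ∅ = ∞`. -/
def hitTime (x : ℝ) (ψ : Path × Path) (ϱ : Control) : EReal :=
  sInf ((fun t : ℝ => (t : EReal)) '' {t : ℝ | 0 ≤ t ∧ G.dyn x ψ ϱ t = 0})

/-- A strategy is admissible for the initial state `x` if the dynamics stay in `[0,D]` until the
termination of the game. -/
def IsAdmissible (x : ℝ) (α : Strategy) : Prop :=
  ∀ (ψ : Path × Path) (t : ℝ), 0 ≤ t → (t : EReal) ≤ G.hitTime x ψ (α ψ) →
    G.dyn x ψ (α ψ) t ∈ Icc 0 G.D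

/-- The path controls for which the dynamics hit zero in finite time. -/
def Q (x : ℝ) (α : Strategy) : Set (Path × Path) := {ψ | G.hitTime x ψ (α ψ) < ⊤}

/-- The rate function of a pair of paths. -/
def rate (T : ℝ) (ψ : Path × Path) : ℝ≥0∞ := pathRate G.c₁ T ψ.1 + pathRate G.c₂ T ψ.2

/-- The cost up to the hitting time, used for controls in `Q`. -/
def cost (x : ℝ) (ψ : Path × Path) (ϱ : Control) : EReal :=
  let τ := (G.hitTime x ψ ϱ).toReal
  (((∫ t in (0 : ℝ)..τ, G.h (G.dyn x ψ ϱ t)) + G.r * ϱ τ : ℝ) : EReal) - (G.rate τ ψ : EReal)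

/-- The best cost that the maximizer can achieve against the strategy `α`. -/
def bestCost (x : ℝ) (α : Strategy) : EReal := ⨆ ψ ∈ G.Q x α, G.cost x ψ (α ψ)

/-- The value of the hitting time game. -/
def U (x : ℝ) : EReal := ⨅ (α : Strategy) (_ : G.IsAdmissible x α), G.bestCost x α

/-- `α` is a `β`-barrier strategy for the initial state `x`: it is admissible and on the time
interval `[0,τ]` the triple `(φ, 0, α[ψ])` is the image under the Skorohod map on `[0,β]` of the
uncontrolled dynamics. -/
def IsBarrierStrategy (x β : ℝ) (α : Strategy) : Prop :=
  G.IsAdmissible x α ∧ ∀ ψ ∈ G.Q x α,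
    IsSkorohodSolution 0 β (G.hitTime x ψ (α ψ)).toReal (G.free x ψ) (G.dyn x ψ (α ψ)) 0 (α ψ)

/-- `δ + ∫₀^{x+yδ} dξ / √(y² - h(ξ)/c)`. -/
def tildeTau (x δ : ℝ) : ℝ :=
  δ + ∫ ξ in (0 : ℝ)..(x + G.y * δ), 1 / √(G.y ^ 2 - G.h ξ / G.c)

/-- `ω` is continuous on `[0,τ̃]`, vanishes on `[0,δ]`, and solves the differential equation on
`[δ,τ̃]`. -/
structure IsOmega (x δ : ℝ) (ω : ℝ → ℝ) : Prop where
  continuousOn : ContinuousOn ω (Icc 0 (G.tildeTau x δ))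
  eq_zero : ∀ t ∈ Icc 0 δ, ω t = 0
  ode : ∀ t ∈ Icc δ (G.tildeTau x δ),
    HasDerivWithinAt ω
      (-G.y - √(G.y ^ 2 - G.h (min (x + G.y * t + ω t) (x + G.y * δ)) / G.c))
      (Icc δ (G.tildeTau x δ)) t

/-- `ψ = ((c/c₁) ω, -(c/c₂) ω)` on `[0,τ̃]`, where `ω` is as above; how `ψ` continues after `τ̃` is
left open, since the game has terminated by then. -/
def IsResponse (x δ : ℝ) (ψ : Path × Path) : Prop :=
  ∃ ω : ℝ → ℝ, G.IsOmega x δ ω ∧ ∀ t ∈ Icc 0 (G.tildeTau x δ),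
    ψ.1 t = G.c / G.c₁ * ω t ∧ ψ.2 t = -G.c / G.c₂ * ω t

/-- The non-degenerate case. -/
def Nondegenerate (x : ℝ) : Prop := 0 < G.y ^ 2 - G.h G.β₀ / G.c ∨ x < G.β₀

/-- The degenerate case. -/
def Degenerate (x : ℝ) : Prop := G.y ^ 2 - G.h G.β₀ / G.c = 0 ∧ x = G.β₀

/-- The values of `δ` that are used: `δ = 0` in the non-degenerate case, and `δ > 0` with
`x + y δ ≥ 0` in the degenerate case. -/
def IsDelay (x δ : ℝ) : Prop :=
  (G.Nondegenerate x ∧ δ = 0) ∨ (G.Degenerate x ∧ 0 < δ ∧ 0 ≤ x + G.y * δ)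

end HittingGame

end

/-! The value is the Hamilton-Jacobi candidate `V(x) = 2c ∫₀ˣ p` with `p = -y - √(y² - h/c)`. By
`c_mul_sq_sub_le` only the difference `v` of the two path velocities matters, at cost `c v²`. The
function `p` solves `h + 2cp(y + v) - c v² ≤ 0` for all `v`, with equality exactly at `v = p`
(`hamilton`). On `[0,β₀]` the definition of `β₀` gives `V' ≤ r` (`feedback_le_penalty`): a rejection
costs at least the value it removes.

Upper bound (`cost_le_candidate`): under a barrier strategy the control is the running excess of the
free path over `β₀` (`IsSkorohodSolution.eq_excess`). Below the barrier the Hamilton-Jacobi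
inequality bounds the rate of gain. At the barrier, completing a square leaves `r²/(4c) + ry + h(β₀)
≤ 0`. Integrating `excess_add_deriv_le` up to termination bounds every cost by `V(x)`.

Lower bound (`candidate_le_bestCost`): against any admissible strategy the maximizer plays `p`,
frozen between the points of a time grid. Causality makes this feedback well defined, the state
moves down at a rate bounded away from zero, and convexity of `V` keeps the total error below `ε
h(x)`. To keep that rate positive, `p` is frozen above a level `z`, chosen below `x` when `x > 0`.

For the explicit response, the state solves the separable equation `φ' = -√(y² - h(φ)/c)`. The
travel time integral determines it and makes it reach `0` exactly at `τ̃` without touching the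
control. The Hamilton-Jacobi equation is an equality along it, so only the initial delay can lose
anything. -/

namespace HittingGame

variable (G : HittingGame)

/-! ### The free boundary and the Hamilton-Jacobi candidate -/

lemma c_pos : 0 < G.c :=
  inv_pos.mpr (add_pos (inv_pos.mpr G.c₁_pos) (inv_pos.mpr G.c₂_pos))

lemma y_neg (hy : G.r / (4 * G.c) ≤ -G.y) : G.y < 0 := by
  have := div_pos G.r_pos (mul_pos four_pos G.c_pos)
  linarith

/-- The verification needs only the inequality, which covers both branches of the definition. In the
second branch `hy` puts the target value above `h 0`, so the intermediate value theorem applies. -/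
lemma β₀_spec (hy : G.r / (4 * G.c) ≤ -G.y) :
    G.β₀ ∈ Icc 0 G.D ∧ G.r ^ 2 / (4 * G.c) + G.r * G.y + G.h G.β₀ ≤ 0 := by
  unfold β₀
  split_ifs with hD
  · exact ⟨⟨G.D_pos.le, le_rfl⟩, by linarith⟩
  · have hex : ∃ b ∈ Icc 0 G.D, G.h b = -G.r ^ 2 / (4 * G.c) - G.r * G.y := by
      refine intermediate_value_Icc G.D_pos.le G.h_continuousOn ⟨?_, ?_⟩
      · rw [G.h_zero]
        have h1 := mul_le_mul_of_nonneg_left hy G.r_pos.le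
        have h2 : G.r * (G.r / (4 * G.c)) = -(-G.r ^ 2 / (4 * G.c)) := by ring
        linarith
      · have : -G.r ^ 2 / (4 * G.c) = -(G.r ^ 2 / (4 * G.c)) := by ring
        linarith
    refine ⟨Function.invFunOn_mem hex, ?_⟩
    rw [Function.invFunOn_eq hex]
    apply le_of_eq
    ring

/-- The projection to `[0,z]`. -/
def trunc (z ξ : ℝ) : ℝ := max 0 (min ξ z)

lemma trunc_mem {z : ℝ} (hz : 0 ≤ z) (ξ : ℝ) : trunc z ξ ∈ Icc 0 z :=
  ⟨le_max_left _ _, max_le hz (min_le_right _ _)⟩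

lemma trunc_eq {z ξ : ℝ} (h : ξ ∈ Icc 0 z) : trunc z ξ = ξ := by
  simp [trunc, h.1, h.2]

lemma trunc_mono (z : ℝ) : Monotone (trunc z) := fun _ _ h =>
  max_le_max le_rfl (min_le_min h le_rfl)

lemma continuous_trunc (z : ℝ) : Continuous (trunc z) := by
  unfold trunc; fun_prop

/-- The holding cost, extended from `[0,z]` by constants. -/
def holding (z ξ : ℝ) : ℝ := G.h (trunc z ξ)

/-- The speed `√(y² - h/c)` of the optimal trajectory, extended from `[0,z]` by constants. -/
noncomputable def speed (z ξ : ℝ) : ℝ := √(G.y ^ 2 - G.holding z ξ / G.c)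

/-- The optimal feedback control `-y - √(y² - h/c)`, extended from `[0,z]` by constants. -/
noncomputable def feedback (z ξ : ℝ) : ℝ := -G.y - G.speed z ξ

/-- The candidate for the value function on `[0,z]`. -/
noncomputable def candidate (z x : ℝ) : ℝ := 2 * G.c * ∫ ξ in (0 : ℝ)..x, G.feedback z ξ

section

variable {G} {z : ℝ}

lemma h_nonneg {ξ : ℝ} (h : ξ ∈ Icc 0 G.D) : 0 ≤ G.h ξ := by
  rw [← G.h_zero]
  exact G.h_strictMonoOn.monotoneOn ⟨le_rfl, G.D_pos.le⟩ h h.1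

lemma Icc_subset (hz : z ∈ Icc 0 G.D) : Icc 0 z ⊆ Icc 0 G.D := Icc_subset_Icc le_rfl hz.2

lemma trunc_mem' (hz : z ∈ Icc 0 G.D) (ξ : ℝ) : trunc z ξ ∈ Icc 0 G.D :=
  Icc_subset hz (trunc_mem hz.1 ξ)

lemma holding_eq {ξ : ℝ} (h : ξ ∈ Icc 0 z) : G.holding z ξ = G.h ξ := by
  rw [holding, trunc_eq h]

lemma holding_mono (hz : z ∈ Icc 0 G.D) : Monotone (G.holding z) := fun _ _ h =>
  G.h_strictMonoOn.monotoneOn (trunc_mem' hz _) (trunc_mem' hz _) (trunc_mono z h)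

lemma holding_le (hz : z ∈ Icc 0 G.D) (ξ : ℝ) : G.holding z ξ ≤ G.h z :=
  G.h_strictMonoOn.monotoneOn (trunc_mem' hz _) hz (trunc_mem hz.1 ξ).2

lemma holding_nonneg (hz : z ∈ Icc 0 G.D) (ξ : ℝ) : 0 ≤ G.holding z ξ :=
  h_nonneg (trunc_mem' hz _)

/-- In the lower bound the state may lie anywhere in `[0,D]`, above the truncation level `z`;
replacing `h` by its truncation then only lowers the cost. -/
lemma holding_le_h (hz : z ∈ Icc 0 G.D) {ξ : ℝ} (hξ : ξ ∈ Icc 0 G.D) :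
    G.holding z ξ ≤ G.h ξ :=
  G.h_strictMonoOn.monotoneOn (trunc_mem' hz _) hξ (max_le hξ.1 (min_le_left _ _))

lemma continuous_holding (hz : z ∈ Icc 0 G.D) : Continuous (G.holding z) :=
  G.h_continuousOn.comp_continuous (continuous_trunc z) (trunc_mem' hz)

lemma continuous_speed (hz : z ∈ Icc 0 G.D) : Continuous (G.speed z) :=
  Real.continuous_sqrt.comp (continuous_const.sub ((continuous_holding hz).div_const _))

lemma continuous_feedback (hz : z ∈ Icc 0 G.D) : Continuous (G.feedback z) :=
  continuous_const.sub (continuous_speed hz)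

lemma speed_antitone (hz : z ∈ Icc 0 G.D) : Antitone (G.speed z) := fun _ _ h =>
  Real.sqrt_le_sqrt (sub_le_sub_left (div_le_div_of_nonneg_right (holding_mono hz h) G.c_pos.le) _)

lemma feedback_mono (hz : z ∈ Icc 0 G.D) : Monotone (G.feedback z) := fun _ _ h =>
  sub_le_sub_left (speed_antitone hz h) _

lemma le_speed (hz : z ∈ Icc 0 G.D) (ξ : ℝ) : √(G.y ^ 2 - G.h z / G.c) ≤ G.speed z ξ :=
  Real.sqrt_le_sqrt (sub_le_sub_left (div_le_div_of_nonneg_right (holding_le hz ξ) G.c_pos.le) _)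

lemma speed_le (hy : G.y < 0) (hz : z ∈ Icc 0 G.D) (ξ : ℝ) : G.speed z ξ ≤ -G.y := by
  refine Real.sqrt_le_iff.mpr ⟨by linarith, ?_⟩
  have := div_nonneg (holding_nonneg hz ξ) G.c_pos.le
  nlinarith

lemma speed_nonneg (ξ : ℝ) : 0 ≤ G.speed z ξ := Real.sqrt_nonneg _

lemma feedback_nonneg (hy : G.y < 0) (hz : z ∈ Icc 0 G.D) (ξ : ℝ) : 0 ≤ G.feedback z ξ :=
  sub_nonneg.mpr (speed_le hy hz ξ)

lemma feedback_le (ξ : ℝ) : G.feedback z ξ ≤ -G.y :=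
  sub_le_self _ (speed_nonneg ξ)

lemma speed_sq (hz : z ∈ Icc 0 G.D) (hyz : 0 ≤ G.y ^ 2 - G.h z / G.c) (ξ : ℝ) :
    G.speed z ξ ^ 2 = G.y ^ 2 - G.holding z ξ / G.c := by
  apply Real.sq_sqrt
  have := div_le_div_of_nonneg_right (holding_le hz ξ) G.c_pos.le
  linarith

/-- The feedback control solves the Hamilton-Jacobi equation. -/
lemma hamilton (hz : z ∈ Icc 0 G.D) (hyz : 0 ≤ G.y ^ 2 - G.h z / G.c) (ξ : ℝ) :
    G.holding z ξ = -G.c * G.feedback z ξ ^ 2 - 2 * G.c * G.y * G.feedback z ξ := by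
  have h1 := speed_sq hz hyz ξ
  have hc := G.c_pos.ne'
  have h2 : G.holding z ξ = G.c * (G.y ^ 2 - G.speed z ξ ^ 2) := by
    rw [h1]; field_simp; ring
  rw [h2, feedback]; ring

/-- Expanding the square turns the claim into the inequality of `β₀_spec`, divided by `c`. It yields
both that the square root is real and that `V' ≤ r`. -/
lemma sq_le_of_le_β₀ (hy : G.r / (4 * G.c) ≤ -G.y) (hz : z ∈ Icc 0 G.β₀) :
    (-G.y - G.r / (2 * G.c)) ^ 2 ≤ G.y ^ 2 - G.h z / G.c := by
  obtain ⟨h1, h2⟩ := G.β₀_spec hy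
  have h3 : G.h z ≤ G.h G.β₀ :=
    G.h_strictMonoOn.monotoneOn ⟨hz.1, hz.2.trans h1.2⟩ h1 hz.2
  have hc := G.c_pos
  have h4 : (G.r ^ 2 / (4 * G.c) + G.r * G.y + G.h z) / G.c ≤ 0 :=
    div_nonpos_of_nonpos_of_nonneg (by linarith) hc.le
  have h5 : (-G.y - G.r / (2 * G.c)) ^ 2 - (G.y ^ 2 - G.h z / G.c) =
      (G.r ^ 2 / (4 * G.c) + G.r * G.y + G.h z) / G.c := by
    field_simp; ring
  linarith

lemma mem_of_le_β₀ (hy : G.r / (4 * G.c) ≤ -G.y) (hz : z ∈ Icc 0 G.β₀) : z ∈ Icc 0 G.D :=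
  ⟨hz.1, hz.2.trans (G.β₀_spec hy).1.2⟩

lemma nonneg_of_le_β₀ (hy : G.r / (4 * G.c) ≤ -G.y) (hz : z ∈ Icc 0 G.β₀) :
    0 ≤ G.y ^ 2 - G.h z / G.c :=
  (sq_nonneg _).trans (sq_le_of_le_β₀ hy hz)

lemma feedback_le_penalty (hy : G.r / (4 * G.c) ≤ -G.y) (hz : z ∈ Icc 0 G.β₀) (ξ : ℝ) :
    2 * G.c * G.feedback z ξ ≤ G.r := by
  have h1 := (le_abs_self _).trans
    ((Real.abs_le_sqrt (sq_le_of_le_β₀ hy hz)).trans (le_speed (mem_of_le_β₀ hy hz) ξ))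
  have hc := G.c_pos
  have h2 : G.feedback z ξ ≤ G.r / (2 * G.c) := by rw [feedback]; linarith
  have h3 := mul_le_mul_of_nonneg_left h2 (by positivity : 0 ≤ 2 * G.c)
  rwa [mul_div_cancel₀ _ (by positivity)] at h3

lemma feedback_congr {z' ξ : ℝ} (h : ξ ∈ Icc 0 z) (h' : ξ ∈ Icc 0 z') :
    G.feedback z ξ = G.feedback z' ξ := by
  rw [feedback, feedback, speed, speed, holding_eq h, holding_eq h']

lemma candidate_zero : G.candidate z 0 = 0 := by simp [candidate]

lemma hasDerivAt_candidate (hz : z ∈ Icc 0 G.D) (ξ : ℝ) :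
    HasDerivAt (G.candidate z) (2 * G.c * G.feedback z ξ) ξ :=
  ((continuous_feedback hz).integral_hasStrictDerivAt 0 ξ).hasDerivAt.const_mul _

lemma candidate_sub (hz : z ∈ Icc 0 G.D) (a b : ℝ) :
    G.candidate z a - G.candidate z b = 2 * G.c * ∫ ξ in b..a, G.feedback z ξ := by
  rw [candidate, candidate, ← mul_sub, intervalIntegral.integral_interval_sub_left] <;>
  exact (continuous_feedback hz).intervalIntegrable _ _

/-- Convexity of `V`, since `feedback` is monotone: the tangent at the upper endpoint bounds the
increment. -/
lemma candidate_sub_le (hz : z ∈ Icc 0 G.D) {a b : ℝ} (h : b ≤ a) :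
    G.candidate z a - G.candidate z b ≤ 2 * G.c * G.feedback z a * (a - b) := by
  rw [candidate_sub hz, mul_assoc (2 * G.c)]
  apply mul_le_mul_of_nonneg_left _ (mul_pos two_pos G.c_pos).le
  have := intervalIntegral.integral_mono_on h ((continuous_feedback hz).intervalIntegrable b a)
    (intervalIntegrable_const (μ := volume) (c := G.feedback z a)) (fun s hs => feedback_mono hz hs.2)
  simpa [mul_comm] using this

lemma candidate_mono (hy : G.y < 0) (hz : z ∈ Icc 0 G.D) : Monotone (G.candidate z) := by
  intro b a h
  rw [← sub_nonneg, candidate_sub hz]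
  exact mul_nonneg (mul_pos two_pos G.c_pos).le
    (intervalIntegral.integral_nonneg h fun s _ => feedback_nonneg hy hz s)

lemma candidate_congr {z' x : ℝ} (hx : 0 ≤ x) (h : x ≤ z) (h' : x ≤ z') :
    G.candidate z x = G.candidate z' x := by
  rw [candidate, candidate]
  congr 1
  apply intervalIntegral.integral_congr
  intro ξ hξ
  rw [uIcc_of_le hx] at hξ
  exact feedback_congr ⟨hξ.1, hξ.2.trans h⟩ ⟨hξ.1, hξ.2.trans h'⟩

lemma candidate_sub_le_penalty (hy : G.r / (4 * G.c) ≤ -G.y) (hz : z ∈ Icc 0 G.β₀) {a b : ℝ}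
    (h : b ≤ a) : G.candidate z a - G.candidate z b ≤ G.r * (a - b) :=
  (candidate_sub_le (mem_of_le_β₀ hy hz) h).trans
    (mul_le_mul_of_nonneg_right (feedback_le_penalty hy hz a) (sub_nonneg.mpr h))

end

end HittingGame

/-! ### The one-sided Skorohod map as a running supremum -/

namespace HittingGame

lemma absolutelyContinuous_of_dist_le {f g : ℝ → ℝ} {a b K : ℝ}
    (hg : AbsolutelyContinuousOnInterval g a b)
    (h : ∀ s ∈ uIcc a b, ∀ t ∈ uIcc a b, dist (f s) (f t) ≤ K * dist (g s) (g t)) :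
    AbsolutelyContinuousOnInterval f a b := by
  have h1 := Filter.Tendsto.const_mul K hg
  rw [mul_zero] at h1
  refine squeeze_zero' (Filter.Eventually.of_forall fun E => Finset.sum_nonneg fun i _ =>
    dist_nonneg) ?_ h1
  filter_upwards [Filter.mem_inf_of_right (Filter.mem_principal_self _)] with E hE
  rw [Finset.mul_sum]
  exact Finset.sum_le_sum fun i hi => h _ (hE.1 i hi).1 _ (hE.1 i hi).2

/-- The running supremum of the excess of `w` over the level `β`. -/
noncomputable def excess (β : ℝ) (w : ℝ → ℝ) (t : ℝ) : ℝ :=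
  sSup ((fun s => max (w s - β) 0) '' Icc 0 t)

section

variable {β s t m : ℝ} {w : ℝ → ℝ}

lemma excess_nonneg : 0 ≤ excess β w t := by
  apply Real.sSup_nonneg
  rintro _ ⟨s, _, rfl⟩
  exact le_max_right _ _

lemma le_excess (hw : ContinuousOn w (Ici 0)) (hs : s ∈ Icc 0 t) : w s - β ≤ excess β w t := by
  refine (le_max_left _ 0).trans (le_csSup ?_ (mem_image_of_mem _ hs))
  apply IsCompact.bddAbove
  apply isCompact_Icc.image_of_continuousOn
  exact ContinuousOn.sup ((hw.mono Icc_subset_Ici_self).sub continuousOn_const) continuousOn_const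

lemma excess_le (hm : 0 ≤ m) (h : ∀ s ∈ Icc 0 t, w s - β ≤ m) : excess β w t ≤ m := by
  refine Real.sSup_le ?_ hm
  rintro _ ⟨s, hs, rfl⟩
  exact max_le (h s hs) hm

lemma excess_mono (hw : ContinuousOn w (Ici 0)) (hst : s ≤ t) : excess β w s ≤ excess β w t :=
  excess_le excess_nonneg fun _ hu => le_excess hw ⟨hu.1, hu.2.trans hst⟩

lemma excess_le_add (hw : ContinuousOn w (Ici 0)) (hs : 0 ≤ s) (hm : 0 ≤ m)
    (h : ∀ u ∈ Icc s t, w u ≤ w s + m) : excess β w t ≤ excess β w s + m := by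
  refine excess_le (add_nonneg excess_nonneg hm) fun u hu => ?_
  rcases le_total u s with hus | hus
  · linarith [le_excess (β := β) hw (⟨hu.1, hus⟩ : u ∈ Icc 0 s)]
  · linarith [h u ⟨hus, hu.2⟩, le_excess (β := β) hw (⟨hs, le_rfl⟩ : s ∈ Icc 0 s)]

lemma excess_le_self (hw : ContinuousOn w (Ici 0))
    (h : ∀ u ∈ Icc s t, w u - β ≤ excess β w s) : excess β w t ≤ excess β w s := by
  refine excess_le excess_nonneg fun u hu => ?_
  rcases le_total u s with hus | hus
  · exact le_excess hw ⟨hu.1, hus⟩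
  · exact h u ⟨hus, hu.2⟩

lemma excess_eq_zero (h : ∀ u ∈ Icc 0 t, w u ≤ β) : excess β w t = 0 :=
  le_antisymm (excess_le le_rfl fun u hu => by linarith [h u hu]) excess_nonneg

lemma continuousOn_excess (hw : ContinuousOn w (Ici 0)) : ContinuousOn (excess β w) (Ici 0) := by
  have key : ∀ d m t₀ : ℝ, 0 ≤ m → (∀ u ∈ Ici 0, dist u t₀ < d → dist (w u) (w t₀) < m / 2) →
      ∀ s t : ℝ, 0 ≤ s → s ≤ t → dist s t₀ < d → dist t t₀ < d →
      excess β w t ≤ excess β w s + m := by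
    intro d m t₀ hm h s t hs hst hsd htd
    refine excess_le_add hw hs hm fun u hu => ?_
    have hud : dist u t₀ < d := by
      rw [Real.dist_eq, abs_lt] at *
      exact ⟨by linarith [hu.1], by linarith [hu.2]⟩
    have h1 := h u (hs.trans hu.1) hud
    have h2 := h s hs hsd
    rw [Real.dist_eq, abs_lt] at h1 h2
    linarith
  rw [Metric.continuousOn_iff]
  intro t₀ ht₀ m hm
  obtain ⟨d, hd, h⟩ := Metric.continuousOn_iff.mp hw t₀ ht₀ (m / 2 / 2) (by positivity)
  refine ⟨d, hd, fun t ht htd => ?_⟩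
  have h0 : dist t₀ t₀ < d := by simpa using hd
  rw [Real.dist_eq, abs_lt]
  rcases le_total t t₀ with htt | htt
  · have := key d (m / 2) t₀ (by positivity) h t t₀ ht htt htd h0
    have := excess_mono (β := β) hw htt
    constructor <;> linarith
  · have := key d (m / 2) t₀ (by positivity) h t₀ t ht₀ htt h0 htd
    have := excess_mono (β := β) hw htt
    constructor <;> linarith

/-- The running supremum cannot grow over `[s,t]` by more than the variation `∫ |w'|` of the input
there. -/
lemma absolutelyContinuous_excess (hw : ContinuousOn w (Ici 0)) {T : ℝ} (hT : 0 ≤ T)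
    (hac : AbsolutelyContinuousOnInterval w 0 T) :
    AbsolutelyContinuousOnInterval (excess β w) 0 T := by
  have hint : IntervalIntegrable (fun s => |deriv w s|) volume 0 T :=
    hac.intervalIntegrable_deriv.abs
  refine absolutelyContinuous_of_dist_le (K := 1)
    (hint.absolutelyContinuousOnInterval_intervalIntegral (c := 0) left_mem_uIcc) ?_
  have key : ∀ s t : ℝ, s ∈ Icc 0 T → t ∈ Icc 0 T → s ≤ t →
      excess β w t - excess β w s ≤
        (∫ u in (0 : ℝ)..t, |deriv w u|) - ∫ u in (0 : ℝ)..s, |deriv w u| := by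
    intro s t hs ht hst
    have hsub : ∀ {a b : ℝ}, a ∈ Icc 0 T → b ∈ Icc 0 T →
        IntervalIntegrable (fun s => |deriv w s|) volume a b := fun ha hb =>
      hint.mono_set (uIcc_subset_uIcc (by rwa [uIcc_of_le hT]) (by rwa [uIcc_of_le hT]))
    have h0 : (0 : ℝ) ∈ Icc 0 T := ⟨le_rfl, hT⟩
    rw [intervalIntegral.integral_interval_sub_left (hsub h0 ht) (hsub h0 hs)]
    rw [sub_le_iff_le_add']
    refine excess_le_add hw hs.1 (intervalIntegral.integral_nonneg hst fun _ _ => abs_nonneg _) ?_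
    intro u hu
    have huT : u ∈ Icc 0 T := ⟨hs.1.trans hu.1, hu.2.trans ht.2⟩
    have hacu : AbsolutelyContinuousOnInterval w s u := hac.mono
      (uIcc_subset_uIcc (by rwa [uIcc_of_le hT]) (by rwa [uIcc_of_le hT]))
    have h1 := hacu.integral_deriv_eq_sub
    have h2 : ∫ v in s..u, deriv w v ≤ ∫ v in s..u, |deriv w v| :=
      intervalIntegral.integral_mono_on hu.1 hacu.intervalIntegrable_deriv (hsub hs huT)
        fun _ _ => le_abs_self _
    have h3 : ∫ v in s..u, |deriv w v| ≤ ∫ v in s..t, |deriv w v| :=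
      intervalIntegral.integral_mono_interval le_rfl hu.1 hu.2
        (Filter.Eventually.of_forall fun _ => abs_nonneg _) (hsub hs ht)
    linarith
  intro s hs t ht
  rw [uIcc_of_le hT] at hs ht
  rw [one_mul, Real.dist_eq, Real.dist_eq]
  rcases le_total s t with hst | hst
  · rw [abs_sub_comm, abs_of_nonneg (sub_nonneg.mpr (excess_mono hw hst)), abs_sub_comm]
    exact (key s t hs ht hst).trans (le_abs_self _)
  · rw [abs_of_nonneg (sub_nonneg.mpr (excess_mono hw hst))]
    exact (key t s ht hs hst).trans (le_abs_self _)

/-- Below the barrier the input needs positive time to set a new record, so the excess is constant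
just after `t`; the right derivative already determines the derivative. -/
lemma deriv_excess_eq_zero (hw : ContinuousOn w (Ici 0)) (ht : 0 ≤ t)
    (hlt : w t - excess β w t < β) (hd : DifferentiableAt ℝ (excess β w) t) :
    deriv (excess β w) t = 0 := by
  have h1 : ∀ᶠ u in nhdsWithin t (Ici t), w u < β + excess β w t :=
    ((hw t ht).mono (Ici_subset_Ici.mpr ht)).eventually_lt_const (by linarith)
  obtain ⟨b, hb, hsub⟩ := mem_nhdsGE_iff_exists_Ico_subset.mp h1
  have h2 : HasDerivWithinAt (excess β w) 0 (Ici t) t := by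
    refine (hasDerivWithinAt_const t _ (excess β w t)).congr_of_eventuallyEq ?_ rfl
    filter_upwards [Ico_mem_nhdsGE hb] with u hu
    refine le_antisymm (excess_le_self hw fun v hv => ?_) (excess_mono hw hu.1)
    have := hsub (⟨hv.1, hv.2.trans_lt hu.2⟩ : v ∈ Ico t b)
    simp only [mem_ofPred_eq] at this
    linarith
  exact (uniqueDiffWithinAt_Ici t).eq_deriv _ hd.hasDerivAt.hasDerivWithinAt h2

/-- The running excess as a control. -/
noncomputable def excessControl (β : ℝ) (w : ℝ → ℝ) (hw : ContinuousOn w (Ici 0)) : Control where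
  toFun := excess β w
  nonneg' _ _ := excess_nonneg
  monotoneOn' _ _ _ _ h := excess_mono hw h
  right_continuous' t ht := (continuousOn_excess hw t ht).mono (Ici_subset_Ici.mpr ht)

lemma stieltjes_of_nonneg (ρ : Control) (ht : 0 ≤ t) : ρ.stieltjes t = ρ t :=
  if_neg (not_lt.mpr ht)

lemma stieltjes_of_neg (ρ : Control) (ht : t < 0) : ρ.stieltjes t = 0 :=
  if_pos ht

lemma zero_stieltjes_measure : (0 : Control).stieltjes.measure = 0 := by
  have : (0 : Control).stieltjes = 0 := by
    ext t
    rcases lt_or_ge t 0 with ht | ht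
    · rw [stieltjes_of_neg _ ht]; rfl
    · rw [stieltjes_of_nonneg _ ht]; rfl
  rw [this, StieltjesFunction.measure_zero]

/-- The solution of the one-sided Skorohod problem is the running excess. -/
lemma IsSkorohodSolution.eq_excess {a T : ℝ} {φ : ℝ → ℝ} {ρ : Control}
    (hw : ContinuousOn w (Ici 0)) (h : IsSkorohodSolution a β T w φ 0 ρ) (ht : t ∈ Icc 0 T) :
    ρ t = excess β w t := by
  have heq : ∀ s ∈ Icc 0 T, φ s = w s - ρ s := by
    intro s hs
    have h1 : φ s = w s + 0 - ρ s := h.eq s hs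
    linarith
  apply le_antisymm
  · by_contra! hlt
    -- On `S` too much has been rejected, so the state is strictly below `β` and the control measure
    -- may not charge `S`. Yet the control has to rise past `excess β w t` on it, either
    -- continuously or by a jump at `inf S`.
    set S : Set ℝ := {s | s ∈ Icc 0 t ∧ excess β w t < ρ s} with hS
    have htS : t ∈ S := ⟨⟨ht.1, le_rfl⟩, hlt⟩
    have hbdd : BddBelow S := ⟨0, fun s hs => hs.1.1⟩
    set s₀ := sInf S
    have hs₀t : s₀ ≤ t := csInf_le hbdd htS
    have hs₀ : 0 ≤ s₀ := le_csInf ⟨t, htS⟩ fun s hs => hs.1.1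
    have hbad : ∀ s ∈ S, s ∈ {s | s ∈ Icc 0 T ∧ φ s ∈ Ico a β} := by
      intro s hs
      have hsT : s ∈ Icc 0 T := ⟨hs.1.1, hs.1.2.trans ht.2⟩
      refine ⟨hsT, (h.mem s hsT).1, ?_⟩
      rw [heq s hsT]
      linarith [hs.2, le_excess (β := β) hw hs.1]
    have hIoc : Ioc s₀ t ⊆ S := by
      intro s hs
      obtain ⟨u, hu, hus⟩ := exists_lt_of_csInf_lt ⟨t, htS⟩ hs.1
      have h0 : 0 ≤ s := hs₀.trans hs.1.le
      exact ⟨⟨h0, hs.2⟩, hu.2.trans_le (ρ.monotoneOn' hu.1.1 h0 hus.le)⟩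
    have hzero : ρ.stieltjes.measure (Ioc s₀ t) = 0 :=
      measure_mono_null (fun s hs => hbad s (hIoc hs)) h.upper
    rw [StieltjesFunction.measure_Ioc, ENNReal.ofReal_eq_zero, stieltjes_of_nonneg _ ht.1,
      stieltjes_of_nonneg _ hs₀] at hzero
    have hs₀S : s₀ ∈ S := ⟨⟨hs₀, hs₀t⟩, by linarith⟩
    have hIcc : Icc s₀ t ⊆ S := by
      intro s hs
      rcases hs.1.eq_or_lt with rfl | hlt'
      · exact hs₀S
      · exact hIoc ⟨hlt', hs.2⟩
    have hzero' : ρ.stieltjes.measure (Icc s₀ t) = 0 :=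
      measure_mono_null (fun s hs => hbad s (hIcc hs)) h.upper
    rw [StieltjesFunction.measure_Icc, ENNReal.ofReal_eq_zero, stieltjes_of_nonneg _ ht.1]
      at hzero'
    -- The left limit brings the atom at `s₀` into the account. If `s₀ = 0` it is the value `0` of
    -- the extension to negative times, so a jump at time zero is covered.
    have hlim : Function.leftLim ρ.stieltjes s₀ ≤ excess β w t := by
      refine le_of_tendsto (ρ.stieltjes.mono.tendsto_leftLim s₀) ?_
      filter_upwards [self_mem_nhdsWithin] with s hs
      rcases lt_or_ge s 0 with hs0 | hs0
      · rw [stieltjes_of_neg _ hs0]; exact excess_nonneg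
      · rw [stieltjes_of_nonneg _ hs0]
        by_contra! hcon
        exact (not_le.mpr hs) (csInf_le hbdd
          (⟨⟨hs0, (le_of_lt hs).trans hs₀t⟩, hcon⟩ : s ∈ S))
    linarith
  · refine excess_le (ρ.nonneg' t ht.1) fun s hs => ?_
    have hsT : s ∈ Icc 0 T := ⟨hs.1, hs.2.trans ht.2⟩
    have h1 := (h.mem s hsT).2
    rw [heq s hsT] at h1
    linarith [ρ.monotoneOn' hs.1 ht.1 hs.2]

lemma isSkorohodSolution_excess {T : ℝ} (hw : ContinuousOn w (Ici 0)) (hw0 : w 0 ≤ β)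
    (hpos : ∀ t ∈ Icc 0 T, 0 ≤ w t - excess β w t) :
    IsSkorohodSolution 0 β T w (fun t => w t - excess β w t) 0 (excessControl β w hw) where
  eq t _ := by
    change _ = w t + 0 - excess β w t
    rw [add_zero]
  mem t ht := ⟨hpos t ht, by
    linarith [le_excess (β := β) hw (⟨ht.1, le_rfl⟩ : t ∈ Icc 0 t)]⟩
  lower := by rw [zero_stieltjes_measure]; rfl
  upper := by
    apply measure_null_of_locally_null
    rintro t ⟨ht, -, hlt⟩
    have hM := continuousOn_excess (β := β) hw
    -- The level `m` separates input and record in a neighbourhood of `t`, so no new record is set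
    -- there and the excess is locally constant.
    obtain ⟨m, hm1, hm2⟩ : ∃ m, w t - β < m ∧ m < excess β w t := exists_between (by linarith)
    have h1 : ∀ᶠ u in nhdsWithin t (Ici 0), w u < β + m ∧ m < excess β w u :=
      ((hw t ht.1).eventually_lt_const (by linarith)).and
        ((hM t ht.1).eventually_const_lt hm2)
    obtain ⟨d, hd, hsub⟩ := Metric.mem_nhdsWithin_iff.mp h1
    have key : ∀ u v : ℝ, 0 ≤ u → u ≤ v → t - d < u → v < t + d →
        excess β w v ≤ excess β w u := by
      intro u v hu huv hut hvt
      refine excess_le_self hw fun s hs => ?_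
      have hs1 := (hsub (⟨?_, hu.trans hs.1⟩ : s ∈ Metric.ball t d ∩ Ici 0)).1
      have hu1 := (hsub (⟨?_, hu⟩ : u ∈ Metric.ball t d ∩ Ici 0)).2
      · linarith
      all_goals
        rw [Metric.mem_ball, Real.dist_eq, abs_lt]
        constructor <;> linarith [hs.1, hs.2]
    obtain ⟨e, he, hed, het⟩ : ∃ e, 0 < e ∧ e < d ∧ (t = 0 ∨ e ≤ t) := by
      rcases ht.1.eq_or_lt with h0 | h0
      · exact ⟨d / 2, by positivity, by linarith, Or.inl h0.symm⟩
      · exact ⟨min (d / 2) t, lt_min (by positivity) h0,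
          (min_le_left _ _).trans_lt (by linarith), Or.inr (min_le_right _ _)⟩
    refine ⟨Ioc (t - e) (t + e), mem_nhdsWithin_of_mem_nhds (Ioc_mem_nhds (by linarith)
      (by linarith)), ?_⟩
    rw [StieltjesFunction.measure_Ioc, ENNReal.ofReal_eq_zero, sub_nonpos,
      stieltjes_of_nonneg _ (by linarith [ht.1])]
    change excess β w (t + e) ≤ _
    -- For `t = 0` the interval starts at negative times, where the extension is `0`; `w 0 ≤ β` then
    -- rules out an atom at `0`.
    rcases het with rfl | het
    · rw [stieltjes_of_neg _ (by linarith)]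
      refine (key 0 _ le_rfl (by linarith) (by linarith) (by linarith)).trans (excess_eq_zero ?_).le
      intro u hu
      rwa [le_antisymm hu.2 hu.1]
    · rw [stieltjes_of_nonneg _ (by linarith)]
      exact key _ _ (by linarith) (by linarith) (by linarith) (by linarith)

end

section

variable {G : HittingGame} {x : ℝ} {ψ : Path × Path} {ρ : Control}

lemma continuousOn_free : ContinuousOn (G.free x ψ) (Ici 0) := by
  unfold free
  exact ((by fun_prop : ContinuousOn (fun t => x + G.y * t) (Ici 0)).add
    ψ.1.continuousOn').sub ψ.2.continuousOn'

lemma free_zero : G.free x ψ 0 = x := by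
  simp [free, ψ.1.map_zero', ψ.2.map_zero']

lemma hitTime_le {t : ℝ} (ht : 0 ≤ t) (h : G.dyn x ψ ρ t = 0) :
    G.hitTime x ψ ρ ≤ (t : EReal) :=
  sInf_le ⟨t, ⟨ht, h⟩, rfl⟩

/-- Right continuity suffices for the infimum to be attained, because zeros can accumulate at it
only from the right. -/
lemma exists_hitTime_eq (h : G.hitTime x ψ ρ < ⊤) :
    ∃ τ : ℝ, 0 ≤ τ ∧ G.hitTime x ψ ρ = τ ∧ G.dyn x ψ ρ τ = 0 := by
  set S : Set ℝ := {t | 0 ≤ t ∧ G.dyn x ψ ρ t = 0} with hS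
  have hne : S.Nonempty := by
    rw [nonempty_iff_ne_empty]
    intro h0
    have : G.hitTime x ψ ρ = sInf ((fun t : ℝ => (t : EReal)) '' S) := rfl
    rw [this, h0, image_empty, sInf_empty] at h
    exact lt_irrefl _ h
  have hbdd : BddBelow S := ⟨0, fun s hs => hs.1⟩
  have h0 : 0 ≤ sInf S := le_csInf hne fun s hs => hs.1
  have hcont : ContinuousWithinAt (G.dyn x ψ ρ) S (sInf S) :=
    (((continuousOn_free _ h0).mono (Ici_subset_Ici.mpr h0)).sub (ρ.right_continuous' _ h0)).mono
      fun s hs => csInf_le hbdd hs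
  have hmem := hcont.mem_closure_image (csInf_mem_closure hne hbdd)
  have hz : G.dyn x ψ ρ (sInf S) = 0 := by
    have : closure (G.dyn x ψ ρ '' S) ⊆ {0} := by
      apply closure_minimal _ isClosed_singleton
      rintro _ ⟨s, hs, rfl⟩
      exact hs.2
    exact this hmem
  refine ⟨sInf S, h0, ?_, hz⟩
  have : IsLeast S (sInf S) := ⟨⟨h0, hz⟩, fun s hs => csInf_le hbdd hs⟩
  exact (EReal.coe_strictMono.monotone.map_isLeast this).csInf_eq

end

/-- The strategy that rejects the running excess over the level `β`. -/
noncomputable def excessStrategy (G : HittingGame) (x β : ℝ) : Strategy where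
  toFun ψ := excessControl β (G.free x ψ) continuousOn_free
  causal' ψ χ t _ h s hs := by
    change sSup _ = sSup _
    congr 1
    apply image_congr
    intro u hu
    have := h u ⟨hu.1, hu.2.trans hs.2⟩
    simp only [free, this.1, this.2]

lemma isBarrierStrategy_excessStrategy {G : HittingGame} {x β : ℝ} (hβ : β ≤ G.D)
    (hx : x ∈ Icc 0 β) : G.IsBarrierStrategy x β (G.excessStrategy x β) := by
  have hdyn : ∀ ψ t, G.dyn x ψ (G.excessStrategy x β ψ) t =
      G.free x ψ t - excess β (G.free x ψ) t := fun _ _ => rfl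
  have hcont : ∀ ψ, ContinuousOn (G.dyn x ψ (G.excessStrategy x β ψ)) (Ici 0) := fun ψ =>
    continuousOn_free.sub (continuousOn_excess continuousOn_free)
  have hpos : ∀ ψ (t : ℝ), 0 ≤ t → (t : EReal) ≤ G.hitTime x ψ (G.excessStrategy x β ψ) →
      0 ≤ G.dyn x ψ (G.excessStrategy x β ψ) t := by
    intro ψ t ht htτ
    by_contra! hneg
    have h0 : G.dyn x ψ (G.excessStrategy x β ψ) 0 = x := by
      rw [hdyn, free_zero, excess_eq_zero, sub_zero]
      intro u hu
      rw [le_antisymm hu.2 hu.1, free_zero]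
      exact hx.2
    -- The running excess has no jumps, so the state is continuous and must pass through `0`, ending
    -- the game, before it can become negative.
    have h3 := intermediate_value_Icc' ht ((hcont ψ).mono Icc_subset_Ici_self)
    rw [h0] at h3
    obtain ⟨s, hs, hs0⟩ := h3 ⟨hneg.le, hx.1⟩
    have h1 := htτ.trans (hitTime_le hs.1 hs0)
    have h2 : s = t := le_antisymm hs.2 (EReal.coe_le_coe_iff.mp h1)
    rw [h2] at hs0
    exact hneg.ne hs0
  refine ⟨fun ψ t ht htτ => ⟨hpos ψ t ht htτ, ?_⟩, fun ψ hψ => ?_⟩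
  · rw [hdyn]
    linarith [le_excess (β := β) (continuousOn_free (G := G) (x := x) (ψ := ψ))
      (⟨ht, le_rfl⟩ : t ∈ Icc 0 t)]
  · obtain ⟨τ, hτ, hτeq, -⟩ := exists_hitTime_eq hψ
    refine isSkorohodSolution_excess continuousOn_free (by rw [free_zero]; exact hx.2) ?_
    intro t ht
    rw [hτeq, EReal.toReal_coe] at ht
    exact hpos ψ t ht.1 (by rw [hτeq]; exact EReal.coe_le_coe_iff.mpr ht.2)

end HittingGame

/-! ### Upper bound: verification along the barrier dynamics -/

namespace HittingGame

lemma pathRate_eq {k T : ℝ} {ψ : Path} (hk : 0 ≤ k) (hT : 0 ≤ T)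
    (hac : AbsolutelyContinuousOnInterval ψ 0 T)
    (hint : IntervalIntegrable (fun s => k * deriv ψ s ^ 2) volume 0 T) :
    pathRate k T ψ = ENNReal.ofReal (∫ s in (0 : ℝ)..T, k * deriv ψ s ^ 2) := by
  rw [pathRate, if_pos hac, intervalIntegral.integral_of_le hT,
    ofReal_integral_eq_lintegral_ofReal hint.1]
  exact Filter.Eventually.of_forall fun s => by positivity

lemma pathRate_eq_top_or {k T : ℝ} (ψ : Path) (hk : 0 ≤ k) (hT : 0 ≤ T) :
    pathRate k T ψ = ⊤ ∨ (AbsolutelyContinuousOnInterval ψ 0 T ∧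
      IntervalIntegrable (fun s => k * deriv ψ s ^ 2) volume 0 T) := by
  by_cases hac : AbsolutelyContinuousOnInterval ψ 0 T
  · rw [or_iff_not_imp_left]
    intro hne
    refine ⟨hac, (intervalIntegrable_iff_integrableOn_Ioc_of_le hT).mpr ⟨?_, ?_⟩⟩
    · exact (((measurable_deriv ψ).pow_const 2).const_mul k).aestronglyMeasurable
    · rw [hasFiniteIntegral_iff_ofReal (Filter.Eventually.of_forall fun s => by positivity)]
      rw [pathRate, if_pos hac] at hne
      exact lt_top_iff_ne_top.mpr hne
  · exact Or.inl (if_neg hac)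

variable {G : HittingGame} {x : ℝ} {ψ : Path × Path} {ρ : Control}

lemma cost_eq {τ I₁ I₂ : ℝ} (hτ : G.hitTime x ψ ρ = τ) (h₁ : 0 ≤ I₁) (h₂ : 0 ≤ I₂)
    (hI₁ : pathRate G.c₁ τ ψ.1 = ENNReal.ofReal I₁)
    (hI₂ : pathRate G.c₂ τ ψ.2 = ENNReal.ofReal I₂) :
    G.cost x ψ ρ = (((∫ t in (0 : ℝ)..τ, G.h (G.dyn x ψ ρ t)) + G.r * ρ τ - (I₁ + I₂) : ℝ) :
      EReal) := by
  rw [cost, hτ, EReal.toReal_coe, rate, hI₁, hI₂, ← ENNReal.ofReal_add h₁ h₂,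
    EReal.coe_ennreal_ofReal, max_eq_left (add_nonneg h₁ h₂), EReal.coe_sub]

lemma cost_eq_bot {τ : ℝ} (hτ : G.hitTime x ψ ρ = τ)
    (h : pathRate G.c₁ τ ψ.1 = ⊤ ∨ pathRate G.c₂ τ ψ.2 = ⊤) : G.cost x ψ ρ = ⊥ := by
  have : G.rate τ ψ = ⊤ := by
    rw [rate]
    rcases h with h | h <;> simp [h]
  rw [cost, hτ, EReal.toReal_coe, this, EReal.coe_ennreal_top, EReal.sub_top]

/-- Only `a - b` enters the dynamics, and `c (a - b)²` is the least cost of producing it; the defect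
is a perfect square over `c₁ + c₂`. -/
lemma c_mul_sq_sub_le (G : HittingGame) (a b : ℝ) :
    G.c * (a - b) ^ 2 ≤ G.c₁ * a ^ 2 + G.c₂ * b ^ 2 := by
  have h1 := G.c₁_pos
  have h2 := G.c₂_pos
  have h3 : G.c₁ * a ^ 2 + G.c₂ * b ^ 2 - G.c * (a - b) ^ 2 =
      (G.c₁ * a + G.c₂ * b) ^ 2 / (G.c₁ + G.c₂) := by
    rw [c]; field_simp; ring
  have h4 : 0 ≤ (G.c₁ * a + G.c₂ * b) ^ 2 / (G.c₁ + G.c₂) := by positivity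
  linarith

/-- Pointwise verification inequality: the rate of holding and rejection cost plus the change of the
candidate never exceeds what the maximizer pays. -/
lemma excess_add_deriv_le (hy : G.r / (4 * G.c) ≤ -G.y) {T t : ℝ} (ht : t ∈ Ioo 0 T)
    (hmem : ∀ s ∈ Icc 0 T, G.free x ψ s - excess G.β₀ (G.free x ψ) s ∈ Icc 0 G.β₀)
    (h₁ : DifferentiableAt ℝ ψ.1 t) (h₂ : DifferentiableAt ℝ ψ.2 t)
    (h₃ : DifferentiableAt ℝ (excess G.β₀ (G.free x ψ)) t) :
    G.h (G.free x ψ t - excess G.β₀ (G.free x ψ) t) +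
      deriv (fun s => G.r * excess G.β₀ (G.free x ψ) s +
        G.candidate G.β₀ (G.free x ψ s - excess G.β₀ (G.free x ψ) s)) t ≤
      G.c₁ * deriv ψ.1 t ^ 2 + G.c₂ * deriv ψ.2 t ^ 2 := by
  obtain ⟨hβ, hβ'⟩ := G.β₀_spec hy
  have hc := G.c_pos
  set M := excess G.β₀ (G.free x ψ)
  set φ : ℝ → ℝ := fun s => G.free x ψ s - M s
  set a := deriv ψ.1 t
  set b := deriv ψ.2 t
  set m := deriv M t
  have hφ : HasDerivAt φ (G.y + a - b - m) t := by
    have h0 : HasDerivAt (fun s => x + G.y * s) G.y t := by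
      simpa using ((hasDerivAt_id t).const_mul G.y).const_add x
    exact ((h0.add h₁.hasDerivAt).sub h₂.hasDerivAt).sub h₃.hasDerivAt
  have hA : HasDerivAt (fun s => G.r * M s + G.candidate G.β₀ (φ s))
      (G.r * m + 2 * G.c * G.feedback G.β₀ (φ t) * (G.y + a - b - m)) t :=
    (h₃.hasDerivAt.const_mul G.r).add ((hasDerivAt_candidate hβ (φ t)).comp t hφ)
  have hφt := hmem t (Ioo_subset_Icc_self ht)
  change G.h (φ t) + deriv (fun s => G.r * M s + G.candidate G.β₀ (φ s)) t ≤ _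
  rw [hA.deriv]
  have hq := G.c_mul_sq_sub_le a b
  rcases hφt.2.eq_or_lt with heq | hlt
  -- At the barrier the state is maximal, so its derivative vanishes and rejection absorbs the whole
  -- velocity: `m = y + a - b`.
  · have hmax : IsLocalMax φ t := by
      filter_upwards [Ioo_mem_nhds ht.1 ht.2] with s hs
      exact (hmem s (Ioo_subset_Icc_self hs)).2.trans heq.ge
    have h0 := hmax.hasDerivAt_eq_zero hφ
    have hm : m = G.y + a - b := by linarith
    have hφβ : φ t = G.β₀ := heq
    rw [h0, mul_zero, add_zero, hφβ, hm]
    have h4 : G.r * (a - b) - G.r ^ 2 / (4 * G.c) =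
        G.c * (a - b) ^ 2 - (2 * G.c * (a - b) - G.r) ^ 2 / (4 * G.c) := by
      field_simp; ring
    have h5 : 0 ≤ (2 * G.c * (a - b) - G.r) ^ 2 / (4 * G.c) := by positivity
    linarith
  -- Below the barrier nothing is rejected; the slack is `c (p - (a - b))²` plus that of
  -- `c_mul_sq_sub_le`.
  · have hm : m = 0 := deriv_excess_eq_zero continuousOn_free ht.1.le hlt h₃
    have hH := hamilton hβ (nonneg_of_le_β₀ hy ⟨hβ.1, le_rfl⟩) (φ t)
    rw [holding_eq hφt] at hH
    change G.h (φ t) = _ at hH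
    rw [hH, hm]
    nlinarith [mul_nonneg hc.le (sq_nonneg (G.feedback G.β₀ (φ t) - (a - b)))]

/-- Against a barrier strategy the maximizer cannot obtain more than the candidate value. -/
theorem cost_le_candidate (hy : G.r / (4 * G.c) ≤ -G.y) (hx : x ∈ Icc 0 G.β₀) {α : Strategy}
    (hα : G.IsBarrierStrategy x G.β₀ α) (hψ : ψ ∈ G.Q x α) :
    G.cost x ψ (α ψ) ≤ (G.candidate G.β₀ x : EReal) := by
  obtain ⟨τ, hτ0, hτ, hzero⟩ := exists_hitTime_eq hψ
  obtain ⟨hβ, -⟩ := G.β₀_spec hy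
  have hsk := hα.2 ψ hψ
  rw [hτ, EReal.toReal_coe] at hsk
  have h₁ := pathRate_eq_top_or ψ.1 G.c₁_pos.le hτ0
  have h₂ := pathRate_eq_top_or ψ.2 G.c₂_pos.le hτ0
  rcases h₁ with h₁ | ⟨hac₁, hint₁⟩
  · rw [cost_eq_bot hτ (Or.inl h₁)]; exact bot_le
  rcases h₂ with h₂ | ⟨hac₂, hint₂⟩
  · rw [cost_eq_bot hτ (Or.inr h₂)]; exact bot_le
  have hnn : ∀ k : ℝ, 0 ≤ k → ∀ f : ℝ → ℝ, 0 ≤ ∫ s in (0 : ℝ)..τ, k * deriv f s ^ 2 :=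
    fun k hk f => intervalIntegral.integral_nonneg hτ0 fun s _ => by positivity
  rw [cost_eq hτ (hnn _ G.c₁_pos.le _) (hnn _ G.c₂_pos.le _)
    (pathRate_eq G.c₁_pos.le hτ0 hac₁ hint₁) (pathRate_eq G.c₂_pos.le hτ0 hac₂ hint₂),
    EReal.coe_le_coe_iff, ← intervalIntegral.integral_add hint₁ hint₂]
  set M := excess G.β₀ (G.free x ψ) with hM
  set φ : ℝ → ℝ := fun s => G.free x ψ s - M s with hφ
  have hρ : ∀ t ∈ Icc 0 τ, α ψ t = M t := fun t ht => hsk.eq_excess continuousOn_free ht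
  have hdyn : ∀ t ∈ Icc 0 τ, G.dyn x ψ (α ψ) t = φ t := fun t ht => by rw [dyn, hρ t ht]
  have hmem : ∀ s ∈ Icc 0 τ, φ s ∈ Icc 0 G.β₀ := fun s hs => hdyn s hs ▸ hsk.mem s hs
  have hτmem : τ ∈ Icc 0 τ := ⟨hτ0, le_rfl⟩
  have hfree : AbsolutelyContinuousOnInterval (G.free x ψ) 0 τ := by
    have h0 : AbsolutelyContinuousOnInterval (fun s => x + G.y * s) 0 τ :=
      ContDiffOn.absolutelyContinuousOnInterval (by fun_prop)
    exact (h0.add hac₁).sub hac₂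
  have hMac : AbsolutelyContinuousOnInterval M 0 τ :=
    absolutelyContinuous_excess continuousOn_free hτ0 hfree
  have hφac : AbsolutelyContinuousOnInterval φ 0 τ := hfree.sub hMac
  have hVac : AbsolutelyContinuousOnInterval (fun s => G.candidate G.β₀ (φ s)) 0 τ := by
    refine absolutelyContinuous_of_dist_le (K := G.r) hφac fun s _ t _ => ?_
    rw [Real.dist_eq, Real.dist_eq]
    have hβ₀ : G.β₀ ∈ Icc 0 G.β₀ := ⟨hβ.1, le_rfl⟩
    have hmono := candidate_mono (G.y_neg hy) hβ
    rcases le_total (φ s) (φ t) with hst | hst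
    · rw [abs_sub_comm, abs_of_nonneg (sub_nonneg.mpr (hmono hst)), abs_sub_comm,
        abs_of_nonneg (sub_nonneg.mpr hst)]
      exact candidate_sub_le_penalty hy hβ₀ hst
    · rw [abs_of_nonneg (sub_nonneg.mpr (hmono hst)), abs_of_nonneg (sub_nonneg.mpr hst)]
      exact candidate_sub_le_penalty hy hβ₀ hst
  set A : ℝ → ℝ := fun s => G.r * M s + G.candidate G.β₀ (φ s) with hA
  have hAac : AbsolutelyContinuousOnInterval A 0 τ := (hMac.const_mul G.r).add hVac
  have hhint : IntervalIntegrable (fun s => G.h (φ s)) volume 0 τ := by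
    apply ContinuousOn.intervalIntegrable
    rw [uIcc_of_le hτ0]
    refine G.h_continuousOn.comp ?_ fun s hs => Icc_subset hβ (hmem s hs)
    simpa [uIcc_of_le hτ0] using hφac.continuousOn
  have hae : (fun s => G.h (φ s) + deriv A s) ≤ᵐ[volume.restrict (Icc 0 τ)]
      fun s => G.c₁ * deriv ψ.1 s ^ 2 + G.c₂ * deriv ψ.2 s ^ 2 := by
    rw [Filter.EventuallyLE, ← restrict_Ioo_eq_restrict_Icc, ae_restrict_iff' measurableSet_Ioo]
    filter_upwards [hac₁.ae_differentiableAt, hac₂.ae_differentiableAt,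
      hMac.ae_differentiableAt] with s h₁ h₂ h₃ hs
    have hs' : s ∈ uIcc 0 τ := by rw [uIcc_of_le hτ0]; exact Ioo_subset_Icc_self hs
    exact excess_add_deriv_le hy hs hmem (h₁ hs') (h₂ hs') (h₃ hs')
  have hle := intervalIntegral.integral_mono_ae_restrict hτ0
    (hhint.add hAac.intervalIntegrable_deriv) (hint₁.add hint₂) hae
  rw [intervalIntegral.integral_add hhint hAac.intervalIntegrable_deriv,
    hAac.integral_deriv_eq_sub] at hle
  have hcongr : ∫ t in (0 : ℝ)..τ, G.h (G.dyn x ψ (α ψ) t) = ∫ t in (0 : ℝ)..τ, G.h (φ t) := by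
    apply intervalIntegral.integral_congr
    intro t ht
    rw [uIcc_of_le hτ0] at ht
    simp only [hdyn t ht]
  have hAτ : A τ = G.r * α ψ τ := by
    rw [hA, hρ τ hτmem]
    simp only
    rw [← hdyn τ hτmem, hzero, candidate_zero, add_zero]
  have hA0 : A 0 = G.candidate G.β₀ x := by
    have hM0 : M 0 = 0 := excess_eq_zero fun u hu => by
      rw [le_antisymm hu.2 hu.1, free_zero]; exact hx.2
    simp [hA, hφ, hM0, free_zero]
  rw [hcongr]
  linarith

end HittingGame

/-! ### Lower bound: discretized feedback against an arbitrary strategy -/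

namespace HittingGame

/-- Each iteration of `F` fixes one more coordinate for good, so the diagonal of the iterates is a
fixed point. This resolves the circularity of playing feedback against a strategy that reacts to it.
-/
lemma exists_causal_sequence (F : (ℕ → ℝ) → ℕ → ℝ)
    (hF : ∀ s s' k, (∀ j < k, s j = s' j) → F s k = F s' k) : ∃ s, ∀ k, s k = F s k := by
  set S : ℕ → ℕ → ℝ := fun n => F^[n] 0 with hS
  have hsucc : ∀ n, S (n + 1) = F (S n) := fun n => Function.iterate_succ_apply' F n 0
  have h1 : ∀ n, ∀ k < n, S (n + 1) k = S n k := by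
    intro n
    induction n with
    | zero => intro k hk; omega
    | succ n ih =>
      intro k hk
      rw [hsucc (n + 1), hsucc n]
      refine hF _ _ k fun j hj => ?_
      rw [← hsucc n]
      exact ih j (by omega)
  have h2 : ∀ j n, j + 1 ≤ n → S n j = S (j + 1) j := by
    intro j n hn
    induction n, hn using Nat.le_induction with
    | base => rfl
    | succ n hn ih => rw [h1 n j (by omega), ih]
  refine ⟨fun k => S (k + 1) k, fun k => ?_⟩
  simp only
  rw [hsucc k]
  exact hF _ _ k fun j hj => h2 j k hj

lemma IsAdmissible.hitTime_lt_top {G : HittingGame} {x μ : ℝ} {α : Strategy} {ψ : Path × Path}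
    (hα : G.IsAdmissible x α) (hμ : 0 < μ)
    (h : ∀ t, 0 ≤ t → G.dyn x ψ (α ψ) t ≤ G.dyn x ψ (α ψ) 0 - μ * t) :
    ψ ∈ G.Q x α := by
  by_contra hQ
  have htop : G.hitTime x ψ (α ψ) = ⊤ := not_lt_top_iff.mp hQ
  have hpos : ∀ t : ℝ, 0 ≤ t → 0 ≤ G.dyn x ψ (α ψ) t := fun t ht =>
    (hα ψ t ht (by rw [htop]; exact le_top)).1
  have h0 := hpos 0 le_rfl
  have ht : 0 ≤ G.dyn x ψ (α ψ) 0 / μ + 1 := by positivity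
  have h1 := h _ ht
  have h2 := hpos _ ht
  rw [mul_add, mul_div_cancel₀ _ hμ.ne'] at h1
  linarith

/-- The pair of paths which realizes a given difference at the least cost. -/
noncomputable def splitPath (G : HittingGame) (ω : ℝ → ℝ) (hω : ContinuousOn ω (Ici 0))
    (h0 : ω 0 = 0) : Path × Path :=
  (⟨fun t => G.c / G.c₁ * ω t, continuousOn_const.mul hω, by simp [h0]⟩,
    ⟨fun t => -G.c / G.c₂ * ω t, continuousOn_const.mul hω, by simp [h0]⟩)

lemma c_identity (G : HittingGame) : G.c / G.c₁ - -G.c / G.c₂ = 1 := by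
  have h1 := G.c₁_pos
  have h2 := G.c₂_pos
  rw [c]; field_simp; ring

lemma c_identity_sq (G : HittingGame) :
    G.c₁ * (G.c / G.c₁) ^ 2 + G.c₂ * (-G.c / G.c₂) ^ 2 = G.c := by
  have h1 := G.c₁_pos
  have h2 := G.c₂_pos
  rw [c]; field_simp

lemma pathRate_eq_of_eqOn {k κ T : ℝ} {ψ : Path} {ω u : ℝ → ℝ} (hk : 0 ≤ k) (hT : 0 ≤ T)
    (hψ : ∀ t ∈ Icc 0 T, ψ t = κ * ω t) (hac : AbsolutelyContinuousOnInterval ω 0 T)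
    (hd : ∀ᵐ t, t ∈ Ioo 0 T → HasDerivAt ω (u t) t)
    (hint : IntervalIntegrable (fun t => u t ^ 2) volume 0 T) :
    pathRate k T ψ = ENNReal.ofReal (k * κ ^ 2 * ∫ t in (0 : ℝ)..T, u t ^ 2) := by
  have hacψ : AbsolutelyContinuousOnInterval ψ 0 T := by
    refine absolutelyContinuous_of_dist_le (K := |κ|) hac fun s hs t ht => ?_
    rw [uIcc_of_le hT] at hs ht
    rw [hψ s hs, hψ t ht, Real.dist_eq, Real.dist_eq, ← mul_sub, abs_mul]
  have hae : (fun t => k * κ ^ 2 * u t ^ 2) =ᵐ[volume.restrict (uIoc 0 T)]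
      fun t => k * deriv ψ t ^ 2 := by
    rw [uIoc_of_le hT, Filter.EventuallyEq, ← restrict_Ioo_eq_restrict_Ioc,
      ae_restrict_iff' measurableSet_Ioo]
    filter_upwards [hd] with t htd ht
    have : HasDerivAt ψ (κ * u t) t := by
      refine ((htd ht).const_mul κ).congr_of_eventuallyEq ?_
      filter_upwards [Ioo_mem_nhds ht.1 ht.2] with s hs
      exact hψ s (Ioo_subset_Icc_self hs)
    rw [this.deriv]; ring
  rw [pathRate_eq hk hT hacψ ((hint.const_mul _).congr_ae hae),
    ← intervalIntegral.integral_const_mul]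
  congr 1
  exact (intervalIntegral.integral_congr_ae_restrict hae).symm

lemma cost_eq_of_split {G : HittingGame} {x T : ℝ} {ψ : Path × Path} {ρ : Control}
    {ω u : ℝ → ℝ} (hT : 0 ≤ T) (hτ : G.hitTime x ψ ρ = T)
    (hψ : ∀ t ∈ Icc 0 T, ψ.1 t = G.c / G.c₁ * ω t ∧ ψ.2 t = -G.c / G.c₂ * ω t)
    (hac : AbsolutelyContinuousOnInterval ω 0 T)
    (hd : ∀ᵐ t, t ∈ Ioo 0 T → HasDerivAt ω (u t) t)
    (hint : IntervalIntegrable (fun t => u t ^ 2) volume 0 T) :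
    G.cost x ψ ρ = (((∫ t in (0 : ℝ)..T, G.h (G.dyn x ψ ρ t)) + G.r * ρ T -
      G.c * ∫ t in (0 : ℝ)..T, u t ^ 2 : ℝ) : EReal) := by
  have h0 : 0 ≤ ∫ t in (0 : ℝ)..T, u t ^ 2 :=
    intervalIntegral.integral_nonneg hT fun _ _ => sq_nonneg _
  have h1 := G.c₁_pos
  have h2 := G.c₂_pos
  rw [cost_eq hτ (by positivity) (by positivity)
    (pathRate_eq_of_eqOn h1.le hT (fun t ht => (hψ t ht).1) hac hd hint)
    (pathRate_eq_of_eqOn h2.le hT (fun t ht => (hψ t ht).2) hac hd hint),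
    ← add_mul, c_identity_sq]

/-- The step function with values `s k` on `[kε, (k+1)ε)`, truncated to `[0,B]`. -/
noncomputable def step (B ε : ℝ) (s : ℕ → ℝ) (t : ℝ) : ℝ := trunc B (s ⌊t / ε⌋₊)

section

variable {B ε : ℝ} {s : ℕ → ℝ}

lemma measurable_step : Measurable (step B ε s) :=
  (continuous_trunc B).measurable.comp
    ((measurable_from_top (f := s)).comp (Nat.measurable_floor.comp (measurable_id.div_const ε)))

lemma step_mem (hB : 0 ≤ B) (t : ℝ) : step B ε s t ∈ Icc 0 B := trunc_mem hB _

lemma step_intervalIntegrable (hB : 0 ≤ B) (a b : ℝ) :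
    IntervalIntegrable (step B ε s) volume a b := by
  refine (intervalIntegrable_const (μ := volume) (c := B)).mono_fun
    measurable_step.aestronglyMeasurable (Filter.Eventually.of_forall fun t => ?_)
  have := step_mem (ε := ε) (s := s) hB t
  change ‖step B ε s t‖ ≤ ‖B‖
  rw [Real.norm_of_nonneg this.1, Real.norm_of_nonneg hB]
  exact this.2

lemma step_sq_intervalIntegrable (hB : 0 ≤ B) (a b : ℝ) :
    IntervalIntegrable (fun t => step B ε s t ^ 2) volume a b := by
  refine (intervalIntegrable_const (μ := volume) (c := B ^ 2)).mono_fun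
    (measurable_step.pow_const 2).aestronglyMeasurable (Filter.Eventually.of_forall fun t => ?_)
  have := step_mem (ε := ε) (s := s) hB t
  change ‖step B ε s t ^ 2‖ ≤ ‖B ^ 2‖
  rw [Real.norm_of_nonneg (sq_nonneg _), Real.norm_of_nonneg (sq_nonneg _)]
  exact pow_le_pow_left₀ this.1 this.2 2

lemma floor_div_eq (hε : 0 < ε) {k : ℕ} {t : ℝ} (h1 : k * ε ≤ t) (h2 : t < (k + 1) * ε) :
    ⌊t / ε⌋₊ = k := by
  have h0 : 0 ≤ t := (by positivity : (0 : ℝ) ≤ k * ε).trans h1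
  rw [Nat.floor_eq_iff (div_nonneg h0 hε.le)]
  exact ⟨(le_div_iff₀ hε).mpr h1, (div_lt_iff₀ hε).mpr h2⟩

lemma continuous_integral_step (hB : 0 ≤ B) :
    Continuous fun t => ∫ v in (0 : ℝ)..t, step B ε s v :=
  intervalIntegral.continuous_primitive (step_intervalIntegrable hB) 0

lemma integral_step_congr (hε : 0 < ε) {s' : ℕ → ℝ} {k : ℕ} (h : ∀ j < k, s j = s' j) {t : ℝ}
    (ht : t ∈ Icc 0 (k * ε)) :
    ∫ v in (0 : ℝ)..t, step B ε s v = ∫ v in (0 : ℝ)..t, step B ε s' v := by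
  refine intervalIntegral.integral_congr_Ioo_of_le ht.1 fun v hv => ?_
  have hlt : ⌊v / ε⌋₊ < k := by
    rw [Nat.floor_lt (div_nonneg hv.1.le hε.le), div_lt_iff₀ hε]
    exact hv.2.trans_le ht.2
  simp only [step, h _ hlt]

lemma integral_comp_step (hε : 0 < ε) (f : ℝ → ℝ) {k : ℕ} {b : ℝ} (h1 : k * ε ≤ b)
    (h2 : b ≤ (k + 1) * ε) :
    ∫ v in (k * ε)..b, f (step B ε s v) = (b - k * ε) * f (trunc B (s k)) := by
  rw [intervalIntegral.integral_congr_Ioo_of_le (g := fun _ => f (trunc B (s k))) h1]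
  · simp
  · intro v hv
    simp only [step, floor_div_eq hε hv.1.le (hv.2.trans_le h2)]

end

lemma exists_discrete_feedback {G : HittingGame} (hy : G.y < 0) {z ε : ℝ} (hε : 0 < ε)
    (x : ℝ) (α : Strategy) :
    ∃ (s : ℕ → ℝ) (ψ : Path × Path),
      (∀ t, ψ.1 t = G.c / G.c₁ * ∫ v in (0 : ℝ)..t, step (-G.y) ε s v) ∧
      (∀ t, ψ.2 t = -G.c / G.c₂ * ∫ v in (0 : ℝ)..t, step (-G.y) ε s v) ∧
      ∀ k : ℕ, s k = G.feedback z (G.dyn x ψ (α ψ) (k * ε)) := by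
  have hB : 0 ≤ -G.y := by linarith
  let path : (ℕ → ℝ) → Path × Path := fun s =>
    G.splitPath (fun t => ∫ v in (0 : ℝ)..t, step (-G.y) ε s v)
      (continuous_integral_step hB).continuousOn intervalIntegral.integral_same
  -- The state at `kε` depends on the path up to `kε` only, by causality of `α`, hence only on the
  -- values `s j` with `j < k`.
  obtain ⟨s, hs⟩ := exists_causal_sequence
    (fun s k => G.feedback z (G.dyn x (path s) (α (path s)) (k * ε))) (by
      intro s s' k h
      have hk : (0 : ℝ) ≤ k * ε := by positivity
      have heq : ∀ t ∈ Icc 0 (k * ε), (path s).1 t = (path s').1 t ∧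
          (path s).2 t = (path s').2 t := by
        intro t ht
        have := integral_step_congr (B := -G.y) hε h ht
        simp only [path, splitPath, this, and_self]
      have hmem : (k * ε) ∈ Icc (0 : ℝ) (k * ε) := ⟨hk, le_rfl⟩
      simp only [dyn, free, α.causal' _ _ _ hk heq _ hmem, (heq _ hmem).1, (heq _ hmem).2])
  exact ⟨s, path s, fun _ => rfl, fun _ => rfl, hs⟩

lemma free_eq_of_split {G : HittingGame} {x t w : ℝ} {ψ : Path × Path}
    (h1 : ψ.1 t = G.c / G.c₁ * w) (h2 : ψ.2 t = -G.c / G.c₂ * w) :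
    G.free x ψ t = x + G.y * t + w := by
  rw [free, h1, h2, add_sub_assoc, ← sub_mul, c_identity, one_mul]

/-- Against any admissible strategy, a discretized feedback control attains the candidate value up
to an error proportional to the mesh. -/
theorem exists_candidate_le_cost {G : HittingGame} {x z ε : ℝ} (hy : G.r / (4 * G.c) ≤ -G.y)
    (hx : x ∈ Icc 0 G.D) (hz : z ∈ Icc 0 G.β₀) (hpos : 0 < G.y ^ 2 - G.h z / G.c)
    {α : Strategy} (hα : G.IsAdmissible x α) (hε : 0 < ε) :
    ∃ ψ ∈ G.Q x α, ((G.candidate z x - ε * G.h x : ℝ) : EReal) ≤ G.cost x ψ (α ψ) := by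
  have hy0 := G.y_neg hy
  have hB : 0 ≤ -G.y := by linarith
  have hzD := mem_of_le_β₀ hy hz
  obtain ⟨s, ψ, hψ1, hψ2, hs⟩ := exists_discrete_feedback hy0 (z := z) hε x α
  set u := step (-G.y) ε s with hu
  set φ := G.dyn x ψ (α ψ) with hφ
  set μ := √(G.y ^ 2 - G.h z / G.c) with hμ
  have hμ0 : 0 < μ := Real.sqrt_pos.mpr hpos
  -- The truncation in `step` keeps the paths bounded for arbitrary sequences; for the sequence
  -- found here it is inactive.
  have htrunc : ∀ k, trunc (-G.y) (s k) = G.feedback z (φ (k * ε)) := fun k => by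
    rw [hs k, trunc_eq ⟨feedback_nonneg hy0 hzD _, feedback_le _⟩]
  have hui : ∀ a b, IntervalIntegrable u volume a b := step_intervalIntegrable hB
  have hui2 : ∀ a b, IntervalIntegrable (fun t => u t ^ 2) volume a b :=
    step_sq_intervalIntegrable hB
  have hule : ∀ t, u t ≤ -G.y - μ := fun t => by
    rw [hu, step, htrunc, feedback]
    linarith [le_speed hzD (φ (⌊t / ε⌋₊ * ε))]
  have hφdiff : ∀ a b, φ b - φ a = G.y * (b - a) + (∫ v in a..b, u v) - (α ψ b - α ψ a) := by
    intro a b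
    rw [← intervalIntegral.integral_interval_sub_left (hui 0 b) (hui 0 a)]
    simp only [hφ, dyn]
    rw [free_eq_of_split (hψ1 a) (hψ2 a), free_eq_of_split (hψ1 b) (hψ2 b)]
    ring
  have hdrift : ∀ a b, 0 ≤ a → a ≤ b → φ b ≤ φ a - μ * (b - a) := by
    intro a b ha hab
    have h1 := intervalIntegral.integral_mono_on hab (hui a b)
      (intervalIntegrable_const (μ := volume) (c := -G.y - μ)) fun v _ => hule v
    rw [intervalIntegral.integral_const, smul_eq_mul] at h1
    have h2 := (α ψ).monotoneOn' ha (ha.trans hab : (0 : ℝ) ≤ b) hab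
    have h3 := hφdiff a b
    linarith
  have hanti : ∀ a b, 0 ≤ a → a ≤ b → φ b ≤ φ a := fun a b ha hab =>
    (hdrift a b ha hab).trans (sub_le_self _ (mul_nonneg hμ0.le (sub_nonneg.mpr hab)))
  have hQ : ψ ∈ G.Q x α := hα.hitTime_lt_top hμ0 fun t ht => by
    simpa using hdrift 0 t le_rfl ht
  obtain ⟨τ, hτ0, hτ, hzero⟩ := exists_hitTime_eq hQ
  refine ⟨ψ, hQ, ?_⟩
  have hmem : ∀ t, 0 ≤ t → t ≤ τ → φ t ∈ Icc 0 G.D := fun t h0 h1 =>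
    hα ψ t h0 (by rw [hτ]; exact EReal.coe_le_coe_iff.mpr h1)
  have hhmono : ∀ a b, 0 ≤ a → a ≤ b → b ≤ τ → G.h (φ b) ≤ G.h (φ a) := fun a b h0 h1 h2 =>
    G.h_strictMonoOn.monotoneOn (hmem b (h0.trans h1) h2) (hmem a h0 (h1.trans h2))
      (hanti a b h0 h1)
  have hhi : ∀ a b, 0 ≤ a → a ≤ b → b ≤ τ → IntervalIntegrable (fun t => G.h (φ t)) volume a b := by
    intro a b h0 h1 h2
    apply AntitoneOn.intervalIntegrable
    rw [uIcc_of_le h1]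
    intro v hv w hw hvw
    exact hhmono v w (h0.trans hv.1) hvw (hw.2.trans h2)
  rw [cost_eq_of_split hτ0 hτ (fun t _ => ⟨hψ1 t, hψ2 t⟩)
    ((hui 0 τ).absolutelyContinuousOnInterval_intervalIntegral left_mem_uIcc)
    (u := u) ?_ (hui2 0 τ), EReal.coe_le_coe_iff]
  swap
  · filter_upwards [(hui 0 τ).ae_hasDerivAt_integral] with t ht htm
    rw [uIcc_of_le hτ0] at ht
    exact ht (Ioo_subset_Icc_self htm) 0 ⟨le_rfl, hτ0⟩
  set C : ℝ → ℝ := fun t => (∫ v in (0 : ℝ)..t, G.h (φ v)) + G.r * α ψ t -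
    G.c * ∫ v in (0 : ℝ)..t, u v ^ 2 with hC
  -- The state decreases, so freezing the feedback costs at most the mesh times the drop of `h`
  -- along the step. These errors telescope over the grid.
  have hstep : ∀ (k : ℕ) (b : ℝ), k * ε ≤ b → b ≤ (k + 1) * ε → b ≤ τ →
      G.candidate z (φ (k * ε)) - G.candidate z (φ b) - ε * (G.h (φ (k * ε)) - G.h (φ b)) ≤
        C b - C (k * ε) := by
    intro k b h1 h2 h3
    have hk : (0 : ℝ) ≤ k * ε := by positivity
    have hb : 0 ≤ b := hk.trans h1
    set a := k * ε with ha
    set p := G.feedback z (φ a) with hp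
    have hI1 : ∫ v in a..b, u v = (b - a) * p := by
      have := integral_comp_step (B := -G.y) (s := s) hε id h1 h2
      simpa only [id, htrunc] using this
    have hI2 : ∫ v in a..b, u v ^ 2 = (b - a) * p ^ 2 := by
      have := integral_comp_step (B := -G.y) (s := s) hε (fun w => w ^ 2) h1 h2
      simpa only [htrunc] using this
    have hI3 : (b - a) * G.h (φ b) ≤ ∫ v in a..b, G.h (φ v) := by
      have := intervalIntegral.integral_mono_on h1
        (intervalIntegrable_const (μ := volume) (c := G.h (φ b))) (hhi a b hk h1 h3)
        fun v hv => hhmono v b (hk.trans hv.1) hv.2 h3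
      rwa [intervalIntegral.integral_const, smul_eq_mul] at this
    have hCdiff : C b - C a = (∫ v in a..b, G.h (φ v)) + G.r * (α ψ b - α ψ a) -
        G.c * ((b - a) * p ^ 2) := by
      rw [← hI2, ← intervalIntegral.integral_interval_sub_left (hui2 0 b) (hui2 0 a),
        ← intervalIntegral.integral_interval_sub_left (hhi 0 b le_rfl hb h3)
          (hhi 0 a le_rfl hk (h1.trans h3))]
      simp only [hC]
      ring
    have hV := candidate_sub_le hzD (hanti a b hk h1)
    have hd := hφdiff a b
    rw [hI1] at hd
    have hρ : 0 ≤ α ψ b - α ψ a := sub_nonneg.mpr ((α ψ).monotoneOn' hk hb h1)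
    have hpr := mul_le_mul_of_nonneg_right (feedback_le_penalty hy hz (φ a)) hρ
    have hH := hamilton hzD hpos.le (φ a)
    have hHle := holding_le_h hzD (hmem a hk (h1.trans h3))
    have hba : 0 ≤ b - a := sub_nonneg.mpr h1
    have hbε : b - a ≤ ε := by rw [ha]; linarith
    have hhab := sub_nonneg.mpr (hhmono a b hk h1 h3)
    have e1 := mul_le_mul_of_nonneg_left hHle hba
    have e2 := mul_le_mul_of_nonneg_right hbε hhab
    rw [hH] at e1
    have e3 : φ a - φ b = -(G.y * (b - a) + (b - a) * p) + (α ψ b - α ψ a) := by linarith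
    rw [e3] at hV
    rw [hCdiff]
    change 2 * G.c * p * _ ≤ _ at hpr
    change (b - a) * (-G.c * p ^ 2 - 2 * G.c * G.y * p) ≤ _ at e1
    change _ ≤ 2 * G.c * p * _ at hV
    linarith
  have hgrid : ∀ k : ℕ, k * ε ≤ τ → G.candidate z x - G.candidate z (φ (k * ε)) -
      ε * (G.h x - G.h (φ (k * ε))) ≤ C (k * ε) := by
    intro k
    induction k with
    | zero =>
      intro _
      have h0 : φ 0 = x - α ψ 0 := by rw [hφ, dyn, free_zero]
      have h1 : 0 ≤ α ψ 0 := (α ψ).nonneg' 0 le_rfl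
      -- The control may jump at time `0`; the penalty for this is at least the loss of candidate
      -- value.
      have h2 := candidate_sub_le_penalty hy hz (sub_le_self x h1)
      have h3 : G.h (φ 0) ≤ G.h x := G.h_strictMonoOn.monotoneOn (hmem 0 le_rfl hτ0) hx
        (by rw [h0]; exact sub_le_self x h1)
      have h4 := mul_nonneg hε.le (sub_nonneg.mpr h3)
      simp only [Nat.cast_zero, zero_mul, hC, intervalIntegral.integral_same]
      rw [h0] at h4 ⊢
      linarith
    | succ k ih =>
      intro hk
      push_cast at hk ⊢
      have hle : (k : ℝ) * ε ≤ (k + 1) * ε := by linarith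
      have h1 := ih (hle.trans hk)
      have h2 := hstep k _ hle le_rfl hk
      linarith
  have hN1 : (⌊τ / ε⌋₊ : ℝ) * ε ≤ τ :=
    (le_div_iff₀ hε).mp (Nat.floor_le (div_nonneg hτ0 hε.le))
  have hN2 : τ ≤ (⌊τ / ε⌋₊ + 1 : ℝ) * ε :=
    ((div_lt_iff₀ hε).mp (Nat.lt_floor_add_one _)).le
  have h1 := hgrid _ hN1
  have h2 := hstep _ τ hN1 hN2 le_rfl
  have h3 : φ τ = 0 := hzero
  rw [h3, candidate_zero, G.h_zero] at h2
  change _ ≤ C τ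
  linarith

/-- Any admissible strategy costs at least the candidate value. -/
theorem candidate_le_bestCost {G : HittingGame} {x : ℝ} (hy : G.r / (4 * G.c) ≤ -G.y)
    (hx : x ∈ Icc 0 G.β₀) {α : Strategy} (hα : G.IsAdmissible x α) :
    (G.candidate G.β₀ x : EReal) ≤ G.bestCost x α := by
  refine le_of_forall_lt fun w hw => ?_
  obtain ⟨v, hwv, hv⟩ := EReal.lt_iff_exists_real_btwn.mp hw
  refine hwv.trans_le ?_
  set e := G.candidate G.β₀ x - v with he
  have he0 : 0 < e := sub_pos.mpr (EReal.coe_lt_coe_iff.mp hv)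
  have hxD := mem_of_le_β₀ hy hx
  have hhx := h_nonneg hxD
  have hr := G.r_pos
  -- At `x = β₀` the speed may vanish. Lowering the level to `z` makes it positive and changes the
  -- candidate by at most `r (x - z) ≤ e/2`; the mesh error uses the other half of `e`.
  obtain ⟨z, hz, hzpos, hze⟩ : ∃ z ∈ Icc 0 x, 0 < G.y ^ 2 - G.h z / G.c ∧
      G.r * (x - z) ≤ e / 2 := by
    rcases hx.1.eq_or_lt with h0 | h0
    · refine ⟨0, ⟨le_rfl, hx.1⟩, ?_, ?_⟩
      · rw [G.h_zero, zero_div, sub_zero]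
        have := (G.y_neg hy).ne
        positivity
      · rw [← h0]; simp only [sub_self, mul_zero]; linarith
    · refine ⟨max 0 (x - e / 2 / G.r), ⟨le_max_left _ _, max_le hx.1 (sub_le_self _ (by positivity))⟩,
        ?_, ?_⟩
      · have hlt : max 0 (x - e / 2 / G.r) < x := max_lt h0 (sub_lt_self _ (by positivity))
        have h1 := G.h_strictMonoOn ⟨le_max_left _ _, hlt.le.trans hxD.2⟩ hxD hlt
        have h2 := nonneg_of_le_β₀ hy hx
        have h3 := div_lt_div_of_pos_right h1 G.c_pos
        linarith
      · have h1 := le_max_right 0 (x - e / 2 / G.r)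
        have h2 : G.r * (x - max 0 (x - e / 2 / G.r)) ≤ G.r * (e / 2 / G.r) :=
          mul_le_mul_of_nonneg_left (by linarith) hr.le
        rwa [mul_div_cancel₀ _ hr.ne'] at h2
  have hzβ : z ∈ Icc 0 G.β₀ := ⟨hz.1, hz.2.trans hx.2⟩
  have hε : 0 < e / 2 / (G.h x + 1) := by positivity
  obtain ⟨ψ, hψ, hle⟩ := exists_candidate_le_cost hy hxD hzβ hzpos hα hε
  refine le_trans ?_ (hle.trans (le_iSup₂ (f := fun ψ _ => G.cost x ψ (α ψ)) ψ hψ))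
  rw [EReal.coe_le_coe_iff]
  have h1 : e / 2 / (G.h x + 1) * G.h x ≤ e / 2 := by
    rw [div_mul_eq_mul_div, div_le_iff₀ (by positivity)]
    linarith
  have h2 := candidate_mono (G.y_neg hy) (mem_of_le_β₀ hy hzβ) hz.2
  have h3 := candidate_congr (G := G) hz.1 (le_refl z) hzβ.2
  have hβ := (G.β₀_spec hy).1
  have h4 := candidate_sub_le_penalty hy (z := G.β₀) ⟨hβ.1, le_rfl⟩ hz.2
  linarith

end HittingGame

/-! ### The optimal response: travel time, trajectory and cost -/

namespace HittingGame

variable {G : HittingGame} {x z δ : ℝ}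

/-- The speed can vanish only at `β₀`, by strict monotonicity of `h`; in the degenerate case the
delay lets the drift move the state off that point. -/
lemma IsDelay.spec (hy : G.r / (4 * G.c) ≤ -G.y) (hx : x ∈ Icc 0 G.β₀) (h : G.IsDelay x δ) :
    0 ≤ δ ∧ x + G.y * δ ∈ Icc 0 G.β₀ ∧ x + G.y * δ ≤ x ∧
      0 < G.y ^ 2 - G.h (x + G.y * δ) / G.c := by
  have hy0 := G.y_neg hy
  have hβ := (G.β₀_spec hy).1
  have hlt : ∀ v, 0 ≤ v → v < G.β₀ → 0 < G.y ^ 2 - G.h v / G.c := by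
    intro v hv hvβ
    have h1 := G.h_strictMonoOn ⟨hv, hvβ.le.trans hβ.2⟩ hβ hvβ
    have h2 := nonneg_of_le_β₀ hy (⟨hβ.1, le_rfl⟩ : G.β₀ ∈ Icc 0 G.β₀)
    have h3 := div_lt_div_of_pos_right h1 G.c_pos
    linarith
  rcases h with ⟨hn, rfl⟩ | ⟨hd, hδ, hpos⟩
  · rw [mul_zero, add_zero]
    refine ⟨le_rfl, hx, le_rfl, ?_⟩
    rcases hx.2.lt_or_eq with h1 | h1
    · exact hlt x hx.1 h1
    · rcases hn with h2 | h2
      · rwa [h1]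
      · exact absurd h1 h2.ne
  · have h1 : x + G.y * δ < x := by nlinarith
    exact ⟨hδ.le, ⟨hpos, h1.le.trans hx.2⟩, h1.le, hlt _ hpos (h1.trans_le hx.2)⟩

/-- The time that the optimal trajectory needs to travel from `ξ` to `0`. -/
noncomputable def travelTime (G : HittingGame) (z ξ : ℝ) : ℝ := ∫ s in (0 : ℝ)..ξ, 1 / G.speed z s

lemma speed_pos (hz : z ∈ Icc 0 G.D) (hpos : 0 < G.y ^ 2 - G.h z / G.c) (ξ : ℝ) :
    0 < G.speed z ξ :=
  (Real.sqrt_pos.mpr hpos).trans_le (le_speed hz ξ)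

lemma continuous_inv_speed (hz : z ∈ Icc 0 G.D) (hpos : 0 < G.y ^ 2 - G.h z / G.c) :
    Continuous fun ξ => 1 / G.speed z ξ :=
  continuous_const.div (continuous_speed hz) fun ξ => (speed_pos hz hpos ξ).ne'

lemma hasDerivAt_travelTime (hz : z ∈ Icc 0 G.D) (hpos : 0 < G.y ^ 2 - G.h z / G.c) (ξ : ℝ) :
    HasDerivAt (G.travelTime z) (1 / G.speed z ξ) ξ :=
  ((continuous_inv_speed hz hpos).integral_hasStrictDerivAt 0 ξ).hasDerivAt

lemma travelTime_zero : G.travelTime z 0 = 0 := intervalIntegral.integral_same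

lemma strictMono_travelTime (hz : z ∈ Icc 0 G.D) (hpos : 0 < G.y ^ 2 - G.h z / G.c) :
    StrictMono (G.travelTime z) :=
  strictMono_of_hasDerivAt_pos (hasDerivAt_travelTime hz hpos)
    fun ξ => one_div_pos.mpr (speed_pos hz hpos ξ)

lemma mul_sub_le_travelTime (hy : G.y < 0) (hz : z ∈ Icc 0 G.D)
    (hpos : 0 < G.y ^ 2 - G.h z / G.c) {a b : ℝ} (hab : a ≤ b) :
    (b - a) * (1 / -G.y) ≤ G.travelTime z b - G.travelTime z a := by
  have hi : ∀ a b, IntervalIntegrable (fun ξ => 1 / G.speed z ξ) volume a b :=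
    (continuous_inv_speed hz hpos).intervalIntegrable
  rw [travelTime, travelTime, intervalIntegral.integral_interval_sub_left (hi _ _) (hi _ _)]
  have := intervalIntegral.integral_mono_on hab
    (intervalIntegrable_const (μ := volume) (c := 1 / -G.y)) (hi a b) fun ξ _ =>
      one_div_le_one_div_of_le (speed_pos hz hpos ξ) (speed_le hy hz ξ)
  rwa [intervalIntegral.integral_const, smul_eq_mul] at this

lemma surjective_travelTime (hy : G.y < 0) (hz : z ∈ Icc 0 G.D)
    (hpos : 0 < G.y ^ 2 - G.h z / G.c) : Function.Surjective (G.travelTime z) := by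
  intro v
  have hv : 0 ≤ |v| * -G.y := mul_nonneg (abs_nonneg v) (by linarith)
  have hcont : Continuous (G.travelTime z) :=
    continuous_iff_continuousAt.mpr fun ξ => (hasDerivAt_travelTime hz hpos ξ).continuousAt
  have h1 := mul_sub_le_travelTime hy hz hpos hv
  have h2 := mul_sub_le_travelTime hy hz hpos (neg_nonpos.mpr hv)
  have h3 : |v| * -G.y * (1 / -G.y) = |v| := by
    have := hy.ne
    field_simp
  rw [travelTime_zero, sub_zero, sub_zero, h3] at h1
  rw [travelTime_zero, zero_sub, zero_sub, neg_neg, h3] at h2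
  have h4 := intermediate_value_Icc (neg_le_self hv) (f := G.travelTime z) hcont.continuousOn
  obtain ⟨ξ, -, hξ⟩ := @h4 v ⟨by linarith [neg_abs_le v], by linarith [le_abs_self v]⟩
  exact ⟨ξ, hξ⟩

lemma tildeTau_eq (hz : 0 ≤ x + G.y * δ) :
    G.tildeTau x δ = δ + G.travelTime (x + G.y * δ) (x + G.y * δ) := by
  rw [tildeTau, travelTime]
  congr 1
  apply intervalIntegral.integral_congr
  intro ξ hξ
  rw [uIcc_of_le hz] at hξ
  simp only [speed, holding_eq hξ]

lemma exists_isOmega (hy : G.y < 0) (hδ : 0 ≤ δ) (hz : x + G.y * δ ∈ Icc 0 G.D)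
    (hpos : 0 < G.y ^ 2 - G.h (x + G.y * δ) / G.c) :
    ∃ ω : ℝ → ℝ, Continuous ω ∧ ω 0 = 0 ∧ G.IsOmega x δ ω := by
  set z := x + G.y * δ with hzdef
  set e := (strictMono_travelTime hz hpos).orderIsoOfSurjective _
    (surjective_travelTime hy hz hpos) with he
  have hee : ∀ v, G.travelTime z (e.symm v) = v := e.apply_symm_apply
  have hez : e.symm (G.travelTime z z) = z := e.symm_apply_apply z
  have he0 : e.symm 0 = 0 := by
    have : e.symm (G.travelTime z 0) = 0 := e.symm_apply_apply 0
    rwa [travelTime_zero] at this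
  have hcont : Continuous e.symm := e.symm.continuous
  have hderiv : ∀ v, HasDerivAt e.symm (G.speed z (e.symm v)) v := by
    intro v
    have := HasDerivAt.of_local_left_inverse hcont.continuousAt
      (hasDerivAt_travelTime hz hpos (e.symm v))
      (one_div_pos.mpr (speed_pos hz hpos _)).ne' (Filter.Eventually.of_forall hee)
    simpa using this
  -- Inverting the travel time solves the separable equation started from `z` at time `δ`; `max t δ`
  -- makes the same formula vanish before `δ`.
  let ω : ℝ → ℝ := fun t => e.symm (G.travelTime z z - (max t δ - δ)) - x - G.y * max t δ
  have hω0 : ∀ t ≤ δ, ω t = 0 := by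
    intro t ht
    simp only [ω, max_eq_right ht, sub_self, sub_zero, hez]
    rw [hzdef]; ring
  have hωc : Continuous ω := by fun_prop
  refine ⟨ω, hωc, hω0 0 hδ, hωc.continuousOn, fun t ht => hω0 t ht.2, fun t ht => ?_⟩
  have hform : ∀ s ∈ Icc δ (G.tildeTau x δ), ω s =
      e.symm (G.travelTime z z - (s - δ)) - x - G.y * s := fun s hs => by
    simp only [ω, max_eq_left hs.1]
  have hd : HasDerivAt (fun s => e.symm (G.travelTime z z - (s - δ)) - x - G.y * s)
      (-G.speed z (e.symm (G.travelTime z z - (t - δ))) - G.y) t := by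
    have h1 : HasDerivAt (fun s => G.travelTime z z - (s - δ)) (-1) t :=
      ((hasDerivAt_id t).sub_const δ).const_sub _
    have h2 := ((hderiv _).comp t h1).sub_const x
    have h3 := h2.sub ((hasDerivAt_id t).const_mul G.y)
    exact h3.congr_deriv (by ring)
  refine (hd.hasDerivWithinAt.congr hform (hform t ht)).congr_deriv ?_
  rw [hform t ht]
  set p := e.symm (G.travelTime z z - (t - δ)) with hp
  have ht2 := ht.2
  rw [tildeTau_eq hz.1, ← hzdef] at ht2
  have hp0 : 0 ≤ p := by
    rw [← he0]
    exact e.symm.monotone (by linarith)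
  have hpz : p ≤ z := by
    rw [← hez]
    exact e.symm.monotone (by linarith [ht.1])
  have h4 : x + G.y * t + (p - x - G.y * t) = p := by ring
  rw [h4, min_eq_left hpz, speed, holding_eq ⟨hp0, hpz⟩]
  ring

/-- The trajectory under `ω` is determined by the travel time. -/
lemma IsOmega.travelTime_eq {ω : ℝ → ℝ} (hω : G.IsOmega x δ ω) (hδ : 0 ≤ δ)
    (hz : x + G.y * δ ∈ Icc 0 G.D) (hpos : 0 < G.y ^ 2 - G.h (x + G.y * δ) / G.c) {t : ℝ}
    (ht : t ∈ Icc δ (G.tildeTau x δ)) :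
    x + G.y * t + ω t ∈ Icc 0 (x + G.y * δ) ∧
      G.travelTime (x + G.y * δ) (x + G.y * t + ω t) = G.tildeTau x δ - t := by
  have hT := tildeTau_eq (G := G) hz.1
  set z := x + G.y * δ with hzdef
  set T := G.tildeTau x δ with hTdef
  set φ : ℝ → ℝ := fun t => x + G.y * t + ω t with hφ
  have hφd : ∀ s ∈ Icc δ T, HasDerivWithinAt φ (-√(G.y ^ 2 - G.h (min (φ s) z) / G.c))
      (Icc δ T) s := by
    intro s hs
    have h1 : HasDerivWithinAt (fun s => x + G.y * s) G.y (Icc δ T) s := by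
      simpa using (((hasDerivAt_id s).const_mul G.y).const_add x).hasDerivWithinAt
    exact (h1.add (hω.ode s hs)).congr_deriv (by ring)
  have hφc : ContinuousOn φ (Icc δ T) := fun s hs => (hφd s hs).continuousWithinAt
  have hφδ : φ δ = z := by
    simp only [hφ, hω.eq_zero δ ⟨hδ, le_rfl⟩, add_zero, hzdef]
  have hanti : AntitoneOn φ (Icc δ T) := by
    refine antitoneOn_of_hasDerivWithinAt_nonpos (convex_Icc δ T) hφc
      (fun s hs => (hφd s (interior_subset hs)).mono interior_subset) fun s _ => ?_
    exact neg_nonpos.mpr (Real.sqrt_nonneg _)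
  have hle : ∀ s ∈ Icc δ T, φ s ≤ z := fun s hs =>
    hφδ ▸ hanti ⟨le_rfl, hs.1.trans hs.2⟩ hs hs.1
  -- Remaining travel time plus elapsed time is conserved as long as the state is in `[0,z]`, where
  -- `h` agrees with its truncation.
  have key : ∀ t₀ ∈ Icc δ T, 0 ≤ φ t₀ → G.travelTime z (φ t₀) = T - t₀ := by
    intro t₀ ht₀ h0
    have hd : ∀ s ∈ Icc δ t₀, HasDerivWithinAt (fun s => G.travelTime z (φ s) + s) 0
        (Icc δ T) s := by
      intro s hs
      have hsT : s ∈ Icc δ T := ⟨hs.1, hs.2.trans ht₀.2⟩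
      have hs0 : φ s ∈ Icc 0 z := ⟨h0.trans (hanti hsT ht₀ hs.2), hle s hsT⟩
      have h1 := ((hasDerivAt_travelTime hz hpos (φ s)).comp_hasDerivWithinAt s
        (hφd s hsT)).add (hasDerivWithinAt_id s (Icc δ T))
      refine h1.congr_deriv ?_
      have h2 := (speed_pos hz hpos (φ s)).ne'
      rw [min_eq_left hs0.2, ← holding_eq hs0]
      change 1 / G.speed z (φ s) * -G.speed z (φ s) + 1 = 0
      field_simp
      ring
    have := constant_of_has_deriv_right_zero (f := fun s => G.travelTime z (φ s) + s)
      (a := δ) (b := t₀)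
      (fun s hs => (hd s hs).continuousWithinAt.mono (Icc_subset_Icc le_rfl ht₀.2))
      (fun s hs => (hd s (Ico_subset_Icc_self hs)).mono_of_mem_nhdsWithin
        (Icc_mem_nhdsGE_of_mem ⟨hs.1, hs.2.trans_le ht₀.2⟩)) t₀ ⟨ht₀.1, le_rfl⟩
    simp only [hφδ] at this
    linarith
  -- The values of `h` below `0` are arbitrary, so staying nonnegative needs an argument: a zero at
  -- `t₀ ≤ t` has no travel time left, hence `t₀ = T`.
  have hnonneg : 0 ≤ φ t := by
    by_contra! hneg
    obtain ⟨t₀, ht₀, h0⟩ := intermediate_value_Icc' ht.1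
      (hφc.mono (Icc_subset_Icc le_rfl ht.2)) (⟨hneg.le, hφδ ▸ hz.1⟩ : (0 : ℝ) ∈ Icc (φ t) (φ δ))
    have h1 := key t₀ ⟨ht₀.1, ht₀.2.trans ht.2⟩ h0.ge
    rw [h0, travelTime_zero] at h1
    have h2 : t₀ = t := le_antisymm ht₀.2 (by linarith [ht.2])
    rw [h2] at h0
    exact hneg.ne h0
  exact ⟨⟨hnonneg, hle t ht⟩, key t ht hnonneg⟩

lemma le_tildeTau (hz : x + G.y * δ ∈ Icc 0 G.D)
    (hpos : 0 < G.y ^ 2 - G.h (x + G.y * δ) / G.c) : δ ≤ G.tildeTau x δ := by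
  rw [tildeTau_eq hz.1]
  have := (strictMono_travelTime hz hpos).monotone hz.1
  rw [travelTime_zero] at this
  linarith

lemma IsOmega.eqOn {ω ω' : ℝ → ℝ} (hω : G.IsOmega x δ ω) (hω' : G.IsOmega x δ ω') (hδ : 0 ≤ δ)
    (hz : x + G.y * δ ∈ Icc 0 G.D) (hpos : 0 < G.y ^ 2 - G.h (x + G.y * δ) / G.c) :
    EqOn ω ω' (Icc 0 (G.tildeTau x δ)) := by
  intro t ht
  rcases le_total t δ with h | h
  · rw [hω.eq_zero t ⟨ht.1, h⟩, hω'.eq_zero t ⟨ht.1, h⟩]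
  · have h1 := (hω.travelTime_eq hδ hz hpos ⟨h, ht.2⟩).2
    have h2 := (hω'.travelTime_eq hδ hz hpos ⟨h, ht.2⟩).2
    exact add_left_cancel ((strictMono_travelTime hz hpos).injective (h1.trans h2.symm))

/-- The trajectory under `ω` stays in `[0,x]`, and it is positive before the time `τ̃`, at which
it vanishes. -/
lemma IsOmega.trajectory {ω : ℝ → ℝ} (hω : G.IsOmega x δ ω) (hy : G.y < 0) (hδ : 0 ≤ δ)
    (hz : x + G.y * δ ∈ Icc 0 G.D) (hpos : 0 < G.y ^ 2 - G.h (x + G.y * δ) / G.c) {t : ℝ}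
    (ht : t ∈ Icc 0 (G.tildeTau x δ)) :
    x + G.y * t + ω t ∈ Icc 0 x ∧ (x + G.y * t + ω t = 0 ↔ t = G.tildeTau x δ) := by
  have hzx : x + G.y * δ ≤ x := by nlinarith
  rcases lt_or_ge t δ with h | h
  · rw [hω.eq_zero t ⟨ht.1, h.le⟩, add_zero]
    have h1 : x + G.y * δ < x + G.y * t := by nlinarith
    have h2 : t < G.tildeTau x δ := h.trans_le (le_tildeTau hz hpos)
    have h3 : 0 < x + G.y * t := hz.1.trans_lt h1
    exact ⟨⟨h3.le, by nlinarith [ht.1]⟩, iff_of_false h3.ne' h2.ne⟩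
  · obtain ⟨h1, h2⟩ := hω.travelTime_eq hδ hz hpos ⟨h, ht.2⟩
    refine ⟨⟨h1.1, h1.2.trans hzx⟩, ?_⟩
    rw [← (strictMono_travelTime hz hpos).injective.eq_iff, h2, travelTime_zero, sub_eq_zero,
      eq_comm]

/-- The dynamics under a barrier strategy and the response built from `ω`. -/
lemma IsBarrierStrategy.response {α : Strategy} {ψ : Path × Path} {ω : ℝ → ℝ}
    (hα : G.IsBarrierStrategy x G.β₀ α) (hx : x ≤ G.β₀) (hω : G.IsOmega x δ ω)
    (hψ : ∀ t ∈ Icc 0 (G.tildeTau x δ),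
      ψ.1 t = G.c / G.c₁ * ω t ∧ ψ.2 t = -G.c / G.c₂ * ω t)
    (hy : G.y < 0) (hδ : 0 ≤ δ)
    (hz : x + G.y * δ ∈ Icc 0 G.D) (hpos : 0 < G.y ^ 2 - G.h (x + G.y * δ) / G.c) :
    G.hitTime x ψ (α ψ) = (G.tildeTau x δ : EReal) ∧
      ∀ t ∈ Icc 0 (G.tildeTau x δ), α ψ t = 0 ∧ G.dyn x ψ (α ψ) t = x + G.y * t + ω t := by
  have hT0 : 0 ≤ G.tildeTau x δ := hδ.trans (le_tildeTau hz hpos)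
  have hfree : ∀ t ∈ Icc 0 (G.tildeTau x δ), G.free x ψ t = x + G.y * t + ω t := fun t ht =>
    free_eq_of_split (hψ t ht).1 (hψ t ht).2
  have htraj := fun t ht => hω.trajectory hy hδ hz hpos (t := t) ht
  set T := G.tildeTau x δ with hT
  have hTmem : T ∈ Icc 0 T := ⟨hT0, le_rfl⟩
  -- The free path is `0` at `T`. If the game were still running, admissibility and nonnegativity of
  -- the control would force the state to be `0` as well.
  have hle : G.hitTime x ψ (α ψ) ≤ T := by
    by_contra! hlt
    have h1 := (hα.1 ψ T hT0 hlt.le).1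
    have h2 := (α ψ).nonneg' T hT0
    have h3 : G.dyn x ψ (α ψ) T = 0 := by
      rw [dyn, hfree T hTmem, ((htraj T hTmem).2.mpr rfl), zero_sub] at h1 ⊢
      linarith
    exact (not_le.mpr hlt) (hitTime_le hT0 h3)
  have hQ : ψ ∈ G.Q x α := hle.trans_lt (EReal.coe_lt_top T)
  obtain ⟨τ, hτ0, hτ, hzero⟩ := exists_hitTime_eq hQ
  have hτT : τ ≤ T := by rwa [hτ, EReal.coe_le_coe_iff] at hle
  have hsk := hα.2 ψ hQ
  rw [hτ, EReal.toReal_coe] at hsk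
  have hρ : ∀ t ∈ Icc 0 τ, α ψ t = 0 := fun t ht => by
    rw [hsk.eq_excess continuousOn_free ht]
    refine excess_eq_zero fun u hu => ?_
    have huT : u ∈ Icc 0 T := ⟨hu.1, (hu.2.trans ht.2).trans hτT⟩
    rw [hfree u huT]
    exact (htraj u huT).1.2.trans hx
  have hτeq : τ = T := by
    rw [dyn, hρ τ ⟨hτ0, le_rfl⟩, sub_zero, hfree τ ⟨hτ0, hτT⟩] at hzero
    exact (htraj τ ⟨hτ0, hτT⟩).2.mp hzero
  subst hτeq
  exact ⟨hτ, fun t ht => ⟨hρ t ht, by rw [dyn, hρ t ht, sub_zero, hfree t ht]⟩⟩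

/-- `I` is the holding cost during the delay, when the maximizer pays nothing. From `δ` on the
integrand is the derivative of `-V(φ)`, so the candidate value at `x + yδ` is collected exactly. -/
lemma IsBarrierStrategy.cost_response {α : Strategy} {ψ : Path × Path}
    (hα : G.IsBarrierStrategy x G.β₀ α) (hx : x ∈ Icc 0 G.β₀) (hψ : G.IsResponse x δ ψ)
    (hy : G.r / (4 * G.c) ≤ -G.y) (hδ : 0 ≤ δ) (hz : x + G.y * δ ∈ Icc 0 G.β₀)
    (hpos : 0 < G.y ^ 2 - G.h (x + G.y * δ) / G.c) :
    ∃ I : ℝ, 0 ≤ I ∧ I ≤ δ * G.h x ∧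
      G.cost x ψ (α ψ) = (I + G.candidate G.β₀ (x + G.y * δ) : ℝ) := by
  obtain ⟨ω, hω, hψω⟩ := hψ
  have hy0 := G.y_neg hy
  have hzD := mem_of_le_β₀ hy hz
  have hxD := mem_of_le_β₀ hy hx
  obtain ⟨hτ, hdyn⟩ := hα.response hx.2 hω hψω hy0 hδ hzD hpos
  have hδT := le_tildeTau hzD hpos
  have htraj := fun t ht => hω.trajectory hy0 hδ hzD hpos (t := t) ht
  have hmemz := fun t ht => (hω.travelTime_eq hδ hzD hpos (t := t) ht).1
  have hcand := candidate_congr (G := G) hz.1 (le_refl (x + G.y * δ)) hz.2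
  have hωδ := hω.eq_zero δ ⟨hδ, le_rfl⟩
  set z := x + G.y * δ with hzdef
  set T := G.tildeTau x δ with hTdef
  have hT0 : 0 ≤ T := hδ.trans hδT
  set φ : ℝ → ℝ := fun t => x + G.y * t + ω t with hφ
  have hφc : ContinuousOn φ (Icc 0 T) :=
    (by fun_prop : ContinuousOn (fun t => x + G.y * t) (Icc 0 T)).add hω.continuousOn
  have hfc : ContinuousOn (fun t => G.feedback z (φ t)) (Icc 0 T) :=
    (continuous_feedback hzD).comp_continuousOn hφc
  have hhc : ContinuousOn (fun t => G.h (φ t)) (Icc 0 T) :=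
    G.h_continuousOn.comp hφc fun t ht => Icc_subset hxD (htraj t ht).1
  set u : ℝ → ℝ := (Ici δ).indicator fun t => G.feedback z (φ t) with hu
  have hu2 : (fun t => u t ^ 2) = (Ici δ).indicator fun t => G.feedback z (φ t) ^ 2 := by
    ext t
    by_cases h : t ∈ Ici δ <;> simp [hu, h]
  have hind : ∀ f : ℝ → ℝ, ContinuousOn f (Icc 0 T) →
      IntervalIntegrable ((Ici δ).indicator f) volume 0 T := by
    intro f hf
    rw [intervalIntegrable_iff_integrableOn_Ioc_of_le hT0]
    exact Integrable.indicator ((hf.integrableOn_Icc).mono_set Ioc_subset_Icc_self)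
      measurableSet_Ici
  have hui : IntervalIntegrable u volume 0 T := hind _ hfc
  have hui2 : IntervalIntegrable (fun t => u t ^ 2) volume 0 T := by
    rw [hu2]; exact hind _ (hfc.pow 2)
  have hωd : ∀ t ∈ Ioo 0 T \ {δ}, HasDerivAt ω (u t) t := by
    rintro t ⟨ht, htδ⟩
    rcases lt_or_gt_of_ne htδ with h | h
    · have hut : u t = 0 := indicator_of_notMem (by simpa using h) _
      rw [hut]
      refine (hasDerivAt_const t (0 : ℝ)).congr_of_eventuallyEq ?_
      filter_upwards [Ioo_mem_nhds ht.1 h] with s hs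
      exact hω.eq_zero s ⟨hs.1.le, hs.2.le⟩
    · have htm : t ∈ Icc δ T := ⟨h.le, ht.2.le⟩
      have hut : u t = G.feedback z (φ t) := indicator_of_mem (show t ∈ Ici δ from h.le) _
      rw [hut]
      refine ((hω.ode t htm).hasDerivAt (Icc_mem_nhds h ht.2)).congr_deriv ?_
      have hm := hmemz t htm
      rw [min_eq_left hm.2, feedback, speed, holding_eq hm]
  have hFTC : ∀ t ∈ Icc 0 T, ω t = ∫ v in (0 : ℝ)..t, u v := by
    intro t ht
    rw [integral_eq_of_hasDerivAt_off_countable_of_le ω u ht.1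
      (countable_singleton δ) (hω.continuousOn.mono (Icc_subset_Icc le_rfl ht.2))
      (fun s hs => hωd s ⟨⟨hs.1.1, hs.1.2.trans_le ht.2⟩, hs.2⟩)
      (hui.mono_set (by rw [uIcc_of_le ht.1, uIcc_of_le hT0]; exact Icc_subset_Icc le_rfl ht.2)),
      hω.eq_zero 0 ⟨le_rfl, hδ⟩, sub_zero]
  have hac : AbsolutelyContinuousOnInterval ω 0 T := by
    refine absolutelyContinuous_of_dist_le (K := 1)
      (hui.absolutelyContinuousOnInterval_intervalIntegral (c := 0) left_mem_uIcc)
      fun s hs t ht => ?_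
    rw [uIcc_of_le hT0] at hs ht
    rw [hFTC s hs, hFTC t ht, one_mul]
  have hsub1 : uIcc 0 δ ⊆ Icc 0 T := by
    rw [uIcc_of_le hδ]; exact Icc_subset_Icc le_rfl hδT
  have hsub2 : uIcc δ T ⊆ Icc 0 T := by
    rw [uIcc_of_le hδT]; exact Icc_subset_Icc hδ le_rfl
  have hI1 : IntervalIntegrable (fun t => G.h (φ t)) volume 0 δ :=
    (hhc.mono hsub1).intervalIntegrable
  have hI2 : IntervalIntegrable (fun t => G.h (φ t)) volume δ T :=
    (hhc.mono hsub2).intervalIntegrable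
  have hu2δ : ∫ t in (0 : ℝ)..δ, u t ^ 2 = 0 := by
    rw [intervalIntegral.integral_congr_Ioo_of_le (g := fun _ => (0 : ℝ)) hδ]
    · simp
    · intro t ht
      have : u t = 0 := indicator_of_notMem (by simpa using ht.2) _
      simp [this]
  have hu2T : ∫ t in δ..T, u t ^ 2 = ∫ t in δ..T, G.feedback z (φ t) ^ 2 := by
    refine intervalIntegral.integral_congr_Ioo_of_le hδT fun t ht => ?_
    have : u t = G.feedback z (φ t) := indicator_of_mem (show t ∈ Ici δ from ht.1.le) _
    simp [this]
  have hsplit : ∫ t in (0 : ℝ)..T, u t ^ 2 = ∫ t in δ..T, G.feedback z (φ t) ^ 2 := by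
    rw [← intervalIntegral.integral_add_adjacent_intervals (b := δ)
      (hui2.mono_set (by rwa [uIcc_of_le hT0])) (hui2.mono_set (by rwa [uIcc_of_le hT0])),
      hu2δ, hu2T, zero_add]
  have hf2 : IntervalIntegrable (fun t => G.feedback z (φ t) ^ 2) volume δ T :=
    ((hfc.pow 2).mono hsub2).intervalIntegrable
  have hφT : φ T = 0 := (htraj T ⟨hT0, le_rfl⟩).2.mpr rfl
  have hφδ : φ δ = z := by simp only [hφ, hωδ, add_zero, hzdef]
  have hV : (∫ t in δ..T, G.h (φ t)) - G.c * ∫ t in δ..T, G.feedback z (φ t) ^ 2 =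
      G.candidate z z := by
    rw [← intervalIntegral.integral_const_mul,
      ← intervalIntegral.integral_sub hI2 (hf2.const_mul _)]
    have h1 : ∀ t ∈ Ioo δ T, HasDerivAt (fun t => -G.candidate z (φ t))
        (G.h (φ t) - G.c * G.feedback z (φ t) ^ 2) t := by
      intro t ht
      have htm : t ∈ Icc δ T := Ioo_subset_Icc_self ht
      have hut : u t = G.feedback z (φ t) := indicator_of_mem (show t ∈ Ici δ from ht.1.le) _
      have hd := hωd t ⟨⟨hδ.trans_lt ht.1, ht.2⟩, ht.1.ne'⟩
      rw [hut] at hd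
      have h0 : HasDerivAt (fun s => x + G.y * s) G.y t := by
        simpa using ((hasDerivAt_id t).const_mul G.y).const_add x
      refine (((hasDerivAt_candidate hzD (φ t)).comp t (h0.add hd)).neg).congr_deriv ?_
      have hH := hamilton hzD hpos.le (φ t)
      rw [holding_eq (hmemz t htm)] at hH
      rw [hH]; ring
    rw [intervalIntegral.integral_eq_sub_of_hasDerivAt_of_le hδT _ h1
      (hI2.sub (hf2.const_mul _)), hφT, hφδ, candidate_zero]
    · ring
    · have hVc : Continuous (G.candidate z) := continuous_iff_continuousAt.mpr fun ξ =>
        (hasDerivAt_candidate hzD ξ).continuousAt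
      exact (hVc.comp_continuousOn (hφc.mono (Icc_subset_Icc hδ le_rfl))).neg
  refine ⟨∫ t in (0 : ℝ)..δ, G.h (φ t), ?_, ?_, ?_⟩
  · exact intervalIntegral.integral_nonneg hδ fun t ht =>
      h_nonneg (Icc_subset hxD (htraj t ⟨ht.1, ht.2.trans hδT⟩).1)
  · have := intervalIntegral.integral_mono_on hδ hI1
      (intervalIntegrable_const (μ := volume) (c := G.h x)) fun t ht => by
        have h1 := (htraj t ⟨ht.1, ht.2.trans hδT⟩).1
        exact G.h_strictMonoOn.monotoneOn (Icc_subset hxD h1) hxD h1.2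
    rwa [intervalIntegral.integral_const, smul_eq_mul, sub_zero] at this
  · have hae : ∀ᵐ t, t ∈ Ioo 0 T → HasDerivAt ω (u t) t := by
      filter_upwards [compl_mem_ae_iff.mpr (measure_singleton δ)] with t ht htm
      exact hωd t ⟨htm, ht⟩
    rw [cost_eq_of_split hT0 hτ hψω hac hae hui2, EReal.coe_eq_coe_iff, (hdyn T ⟨hT0, le_rfl⟩).1,
      hsplit, mul_zero, add_zero, ← hcand, ← hV]
    have hc1 : ∫ t in (0 : ℝ)..T, G.h (G.dyn x ψ (α ψ) t) = ∫ t in (0 : ℝ)..T, G.h (φ t) := by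
      apply intervalIntegral.integral_congr
      intro t ht
      rw [uIcc_of_le hT0] at ht
      simp only [(hdyn t ht).2, hφ]
    rw [hc1, ← intervalIntegral.integral_add_adjacent_intervals hI1 hI2]
    ring

end HittingGame

/-! ### The value of the game and the optimality of the response -/

theorem mainTheorem8 (G : HittingGame)
    (hy : G.r / (4 * G.c) ≤ -G.y)
    (hLip : ∃ K, LipschitzOnWith K G.h (Set.Icc 0 G.D))
    (x : ℝ) (hx : x ∈ Set.Icc 0 G.β₀) :
    -- a barrier strategy at the free boundary exists
    (∃ α, G.IsBarrierStrategy x G.β₀ α) ∧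
    -- the control is well defined
    (∀ δ, G.IsDelay x δ → (∃ ψ, G.IsResponse x δ ψ) ∧
      ∀ ω ω', G.IsOmega x δ ω → G.IsOmega x δ ω' →
        Set.EqOn ω ω' (Set.Icc 0 (G.tildeTau x δ))) ∧
    -- the termination time
    (∀ δ, G.IsDelay x δ → ∀ α, G.IsBarrierStrategy x G.β₀ α → ∀ ψ, G.IsResponse x δ ψ →
      G.hitTime x ψ (α ψ) = (G.tildeTau x δ : EReal)) ∧
    -- the value is finite and is the best that the maximizer can do against the barrier strategy
    ∃ u : ℝ, G.U x = u ∧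
      (∀ α, G.IsBarrierStrategy x G.β₀ α → G.bestCost x α = u) ∧
      -- exact optimality
      (G.Nondegenerate x → ∀ α, G.IsBarrierStrategy x G.β₀ α → ∀ ψ, G.IsResponse x 0 ψ →
        G.cost x ψ (α ψ) = u) ∧
      -- optimality up to a multiple of the delay
      (G.Degenerate x → ∃ C : ℝ, 0 < C ∧ ∀ δ, 0 < δ → 0 ≤ x + G.y * δ →
        ∀ α, G.IsBarrierStrategy x G.β₀ α → ∀ ψ, G.IsResponse x δ ψ →
          ∃ v : ℝ, G.cost x ψ (α ψ) = v ∧ |v - u| ≤ C * δ) := by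
  have hy0 := G.y_neg hy
  have hβ := (G.β₀_spec hy).1
  have hex := HittingGame.isBarrierStrategy_excessStrategy hβ.2 hx
  have hbest : ∀ α, G.IsBarrierStrategy x G.β₀ α → G.bestCost x α = G.candidate G.β₀ x :=
    fun α hα => le_antisymm (iSup₂_le fun ψ hψ => HittingGame.cost_le_candidate hy hx hα hψ)
      (HittingGame.candidate_le_bestCost hy hx hα.1)
  refine ⟨⟨_, hex⟩, fun δ hδ => ?_, fun δ hδ α hα ψ hψ => ?_, G.candidate G.β₀ x, ?_, hbest,
    fun hn α hα ψ hψ => ?_, fun hd => ?_⟩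
  · obtain ⟨h0, hz, -, hpos⟩ := hδ.spec hy hx
    have hzD := HittingGame.mem_of_le_β₀ hy hz
    obtain ⟨ω, hωc, hω0, hω⟩ := HittingGame.exists_isOmega hy0 h0 hzD hpos
    exact ⟨⟨G.splitPath ω hωc.continuousOn hω0, ω, hω, fun t _ => ⟨rfl, rfl⟩⟩,
      fun ω ω' hω hω' => hω.eqOn hω' h0 hzD hpos⟩
  · obtain ⟨h0, hz, -, hpos⟩ := hδ.spec hy hx
    obtain ⟨ω, hω, hψω⟩ := hψ
    exact (hα.response hx.2 hω hψω hy0 h0 (HittingGame.mem_of_le_β₀ hy hz) hpos).1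
  · exact le_antisymm ((iInf₂_le _ hex.1).trans (hbest _ hex).le)
      (le_iInf₂ fun α hα => HittingGame.candidate_le_bestCost hy hx hα)
  · obtain ⟨h0, hz, -, hpos⟩ := HittingGame.IsDelay.spec hy hx (Or.inl ⟨hn, rfl⟩ : G.IsDelay x 0)
    obtain ⟨I, hI0, hI1, hcost⟩ := hα.cost_response hx hψ hy h0 hz hpos
    rw [hcost, mul_zero, add_zero]
    rw [zero_mul] at hI1
    rw [le_antisymm hI1 hI0, zero_add]
  · have hr := G.r_pos
    have hhx := HittingGame.h_nonneg (HittingGame.mem_of_le_β₀ hy hx)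
    -- The delay adds at most `δ h(x)` of holding cost and lowers the candidate by at most `r (-y)
    -- δ`, since its slope is at most `r`.
    refine ⟨G.h x + G.r * -G.y, by nlinarith, fun δ hδ hδ' α hα ψ hψ => ?_⟩
    obtain ⟨h0, hz, hzx, hpos⟩ := HittingGame.IsDelay.spec hy hx (Or.inr ⟨hd, hδ, hδ'⟩ : G.IsDelay x δ)
    obtain ⟨I, hI0, hI1, hcost⟩ := hα.cost_response hx hψ hy h0 hz hpos
    refine ⟨_, hcost, ?_⟩
    have h1 := HittingGame.candidate_mono hy0 hβ hzx
    have h2 := HittingGame.candidate_sub_le_penalty hy (z := G.β₀) ⟨hβ.1, le_rfl⟩ hzx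
    rw [abs_le]
    constructor <;> nlinarith
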